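/- Let $S = V\bigl((y_2^3-y_1^3)y_1+(x_1^3-x_0^3)x_0\bigr) \subset \mathbb{P}^3_{\mathbb C}$, where $(y_2:y_1:x_1:x_0)$ are homogeneous coordinates on $\mathbb{P}^3_{\mathbb C}$ ($S$ is a smooth quartic, hence a $K3$ surface). Let $\xi = e^{2\pi i/3}$ and let $\gamma : S \to S$ be the automorphism $$(y_2:y_1:x_1:x_0) \mapsto (\xi y_2:y_1:\xi x_1:x_0).$$ Then $\gamma$ has order $3$, the complex vector space $\Gamma(\omega_S) = \Gamma(S, \Omega^2_{S/\mathbb C})$ of global $2$-forms on $S$ is one-dimensional, and $\gamma$ acts on it via pullback as multiplication by $\xi^2$: $\gamma^*\omega = \xi^2\,\omega$ for every $\omega \in \Gamma(\omega_S)$. -/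

import Mathlib

noncomputable section

namespace QuarticK3

open AlgebraicGeometry CategoryTheory TopologicalSpace
open scoped KaehlerDifferential

section Forms

variable {k A B C : Type} [CommRing k] [CommRing A] [CommRing B] [CommRing C]
  [Algebra k A] [Algebra k B] [Algebra k C]

/-- The map `Ω^n_{A/k} → Ω^n_{B/k}` induced by a homomorphism `φ : A → B` of `k`-algebras:
`a • (da₁ ∧ ⋯ ∧ daₙ) ↦ φ a • (d(φ a₁) ∧ ⋯ ∧ d(φ aₙ))`. -/
def formsMap (n : ℕ) (φ : A →ₐ[k] B) : (⋀[A]^n Ω[A⁄k]) →ₗ[k] (⋀[B]^n Ω[B⁄k]) :=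
  letI : Algebra A B := φ.toRingHom.toAlgebra
  haveI : IsScalarTower k A B := IsScalarTower.of_algebraMap_eq' φ.comp_algebraMap.symm
  (exteriorPower.alternatingMapLinearEquiv
    { toFun := fun v => exteriorPower.ιMulti B n fun i => KaehlerDifferential.map k k A B (v i)
      map_update_add' := fun v i x y => by
        classical
        simp only [Function.apply_update (fun _ => KaehlerDifferential.map k k A B), map_add]
        convert (exteriorPower.ιMulti B n).map_update_add _ i _ _
      map_update_smul' := fun v i c x => by
        classical
        simp only [Function.apply_update (fun _ => KaehlerDifferential.map k k A B), map_smul]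
        simp only [← algebraMap_smul B c]
        convert (exteriorPower.ιMulti B n).map_update_smul _ i _ _
      map_eq_zero_of_eq' := fun v i j h hij =>
        (exteriorPower.ιMulti B n).map_eq_zero_of_eq _ (by simp [h]) hij } :
    (⋀[A]^n Ω[A⁄k]) →ₗ[A] (⋀[B]^n Ω[B⁄k])).restrictScalars k

theorem formsMap_ιMulti_D (n : ℕ) (φ : A →ₐ[k] B) (v : Fin n → A) :
    formsMap n φ (exteriorPower.ιMulti A n fun i => KaehlerDifferential.D k A (v i)) =
      exteriorPower.ιMulti B n fun i => KaehlerDifferential.D k B (φ (v i)) := by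
  let _ : Algebra A B := φ.toRingHom.toAlgebra
  have : IsScalarTower k A B := IsScalarTower.of_algebraMap_eq' φ.comp_algebraMap.symm
  simp only [formsMap, LinearMap.restrictScalars_apply,
    exteriorPower.alternatingMapLinearEquiv_apply_ιMulti]
  change exteriorPower.ιMulti B n (fun i => KaehlerDifferential.map k k A B _) = _
  simp only [KaehlerDifferential.map_D]
  rfl

theorem formsMap_smul (n : ℕ) (φ : A →ₐ[k] B) (a : A) (w : ⋀[A]^n Ω[A⁄k]) :
    formsMap n φ (a • w) = φ a • formsMap n φ w := by
  let _ : Algebra A B := φ.toRingHom.toAlgebra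
  have : IsScalarTower k A B := IsScalarTower.of_algebraMap_eq' φ.comp_algebraMap.symm
  simp only [formsMap, LinearMap.restrictScalars_apply, map_smul]
  rw [← algebraMap_smul B a]
  rfl

theorem span_ιMulti_D (n : ℕ) : Submodule.span A (Set.range fun v : Fin n → A =>
    exteriorPower.ιMulti A n fun i => KaehlerDifferential.D k A (v i)) = ⊤ := by
  rw [eq_top_iff, ← exteriorPower.ιMulti_span_of_span A n _
    (KaehlerDifferential.span_range_derivation k A)]
  refine Submodule.span_mono ?_
  rintro _ ⟨v, hv, rfl⟩
  choose w hw using fun i => hv ⟨i, rfl⟩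
  exact ⟨w, by simp only [hw]⟩

theorem formsMap_comp (n : ℕ) (φ : A →ₐ[k] B) (ψ : B →ₐ[k] C) (w : ⋀[A]^n Ω[A⁄k]) :
    formsMap n (ψ.comp φ) w = formsMap n ψ (formsMap n φ w) := by
  have hw : w ∈ Submodule.span A (Set.range fun v : Fin n → A =>
    exteriorPower.ιMulti A n fun i => KaehlerDifferential.D k A (v i)) := by
    rw [span_ιMulti_D]; trivial
  induction hw using Submodule.span_induction with
  | mem x h => obtain ⟨v, rfl⟩ := h; simp [formsMap_ιMulti_D]
  | zero => simp
  | add x y _ _ hx hy => simp [hx, hy]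
  | smul a x _ hx => simp [formsMap_smul, hx]

end Forms

section Schemes

variable {k : Type} [CommRing k]

/-- The regular functions on an open set of a `k`-scheme form a `k`-algebra. -/
instance sectionsAlgebra (X : Over (Spec (.of k))) (U : X.left.Opens) :
    Algebra k Γ(X.left, U) :=
  ((Scheme.ΓSpecIso (.of k)).inv ≫ X.hom.appLE ⊤ U le_top).hom.toAlgebra

/-- The local rings of a `k`-scheme are `k`-algebras. -/
instance stalkAlgebra (X : Over (Spec (.of k))) (x : X.left) :
    Algebra k (X.left.presheaf.stalk x) :=
  ((X.left.presheaf.germ ⊤ x trivial).hom.comp (algebraMap k Γ(X.left, ⊤))).toAlgebra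

/-- The germ at `x` of regular functions on `U ∋ x`, as a `k`-algebra homomorphism. -/
def germHom (X : Over (Spec (.of k))) (U : X.left.Opens) (x : X.left) (hx : x ∈ U) :
    Γ(X.left, U) →ₐ[k] X.left.presheaf.stalk x where
  toRingHom := (X.left.presheaf.germ U x hx).hom
  commutes' r := by
    change (((Scheme.ΓSpecIso (.of k)).inv ≫ X.hom.appLE ⊤ U le_top) ≫
        X.left.presheaf.germ U x hx).hom r =
      (((Scheme.ΓSpecIso (.of k)).inv ≫ X.hom.appLE ⊤ ⊤ le_top) ≫
        X.left.presheaf.germ ⊤ x trivial).hom r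
    rw [← X.left.presheaf.germ_res (homOfLE (le_top : U ≤ ⊤)) x hx]
    have h := Scheme.Hom.appLE_map (X := X.left) (Y := Spec (.of k)) X.hom (U := ⊤)
      (V := ⊤) le_top (homOfLE (le_top : U ≤ ⊤)).op
    rw [← h]
    simp only [Category.assoc]

/-- The homomorphism `Γ(Y, U) → Γ(X, f⁻¹ U)` of a morphism `f : X → Y` of `k`-schemes. -/
def appHom {X Y : Over (Spec (.of k))} (f : X ⟶ Y) (U : Y.left.Opens) :
    Γ(Y.left, U) →ₐ[k] Γ(X.left, f.left ⁻¹ᵁ U) where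
  toRingHom := (f.left.app U).hom
  commutes' r := by
    change (((Scheme.ΓSpecIso (.of k)).inv ≫ Y.hom.appLE ⊤ U le_top) ≫ f.left.app U).hom r =
      ((Scheme.ΓSpecIso (.of k)).inv ≫ X.hom.appLE ⊤ (f.left ⁻¹ᵁ U) le_top).hom r
    have h : X.hom = f.left ≫ Y.hom := (Over.w f).symm
    have h' := Scheme.Hom.appLE_comp_appLE (X := X.left) (Y := Y.left) (Z := Spec (.of k))
      f.left Y.hom ⊤ U (f.left ⁻¹ᵁ U) le_top le_rfl
    simp only [h, Category.assoc, Scheme.Hom.app_eq_appLE]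
    exact congr(((Scheme.ΓSpecIso (.of k)).inv ≫ $h').hom r)

/-- The homomorphism `𝒪_{Y, f x} → 𝒪_{X, x}` of a morphism `f : X → Y` of `k`-schemes. -/
def stalkHom {X Y : Over (Spec (.of k))} (f : X ⟶ Y) (x : X.left) :
    Y.left.presheaf.stalk (f.left x) →ₐ[k] X.left.presheaf.stalk x where
  toRingHom := (f.left.stalkMap x).hom
  commutes' r := by
    have h := congr($(Scheme.Hom.germ_stalkMap f.left ⊤ x trivial).hom (algebraMap k _ r))
    exact h.trans (congrArg _ ((appHom f ⊤).commutes r))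

theorem stalkHom_comp_germHom {X Y : Over (Spec (.of k))} (f : X ⟶ Y) (U : Y.left.Opens)
    (x : X.left) (hx : f.left x ∈ U) :
    (stalkHom f x).comp (germHom Y U (f.left x) hx) =
      (germHom X (f.left ⁻¹ᵁ U) x hx).comp (appHom f U) := by
  ext r
  exact congr($(Scheme.Hom.germ_stalkMap f.left U x hx).hom r)

/-- The restriction homomorphism `Γ(X, U) → Γ(X, V)` for `V ⊆ U`. -/
def resHom (X : Over (Spec (.of k))) {U V : X.left.Opens} (h : V ≤ U) :
    Γ(X.left, U) →ₐ[k] Γ(X.left, V) where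
  toRingHom := (X.left.presheaf.map (homOfLE h).op).hom
  commutes' r := by
    change (((Scheme.ΓSpecIso (.of k)).inv ≫ X.hom.appLE ⊤ U le_top) ≫
      X.left.presheaf.map (homOfLE h).op).hom r =
      ((Scheme.ΓSpecIso (.of k)).inv ≫ X.hom.appLE ⊤ V le_top).hom r
    have h' := Scheme.Hom.appLE_map (X := X.left) (Y := Spec (.of k)) X.hom (U := ⊤)
      (V := U) le_top (homOfLE h).op
    simp only [Category.assoc]
    exact congr(((Scheme.ΓSpecIso (.of k)).inv ≫ $h').hom r)

theorem germHom_comp_resHom (X : Over (Spec (.of k))) {U V : X.left.Opens} (h : V ≤ U)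
    (x : X.left) (hx : x ∈ V) :
    (germHom X V x hx).comp (resHom X h) = germHom X U x (h hx) := by
  ext r
  exact congr($(X.left.presheaf.germ_res (homOfLE h) x hx).hom r)

/-- A family of germs of `n`-forms which, near every point, consists of the germs of one `n`-form
defined on an open neighbourhood. -/
def IsLocallyForm (X : Over (Spec (.of k))) (n : ℕ)
    (s : ∀ x : X.left, ⋀[X.left.presheaf.stalk x]^n Ω[X.left.presheaf.stalk x⁄k]) : Prop :=
  ∀ x : X.left, ∃ (U : X.left.Opens) (_ : x ∈ U) (η : ⋀[Γ(X.left, U)]^n Ω[Γ(X.left, U)⁄k]),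
    ∀ (y : X.left) (hy : y ∈ U), s y = formsMap n (germHom X U y hy) η

/-- `Γ(X, Ω^n_{X/k})`, the global sections of the sheaf of `n`-forms of a `k`-scheme `X`, i.e. of
the sheaf associated with the presheaf `U ↦ ⋀ⁿ Ω_{Γ(X, U)/k}`, whose stalk at `x` is
`⋀ⁿ Ω_{𝒪_{X,x}/k}`. -/
def globalForms (X : Over (Spec (.of k))) (n : ℕ) :
    Submodule k (∀ x : X.left,
      ⋀[X.left.presheaf.stalk x]^n Ω[X.left.presheaf.stalk x⁄k]) where
  carrier := {s | IsLocallyForm X n s}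
  add_mem' {s t} hs ht := by
    intro x
    obtain ⟨U, hxU, η, hη⟩ := hs x
    obtain ⟨V, hxV, θ, hθ⟩ := ht x
    refine ⟨U ⊓ V, ⟨hxU, hxV⟩,
      formsMap n (resHom X inf_le_left) η + formsMap n (resHom X inf_le_right) θ, ?_⟩
    intro y hy
    rw [map_add, ← formsMap_comp, ← formsMap_comp, germHom_comp_resHom, germHom_comp_resHom,
      ← hη y hy.1, ← hθ y hy.2]
    rfl
  zero_mem' := fun x => ⟨⊤, trivial, 0, fun y hy => by rw [map_zero]; rfl⟩
  smul_mem' c s hs := by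
    intro x
    obtain ⟨U, hxU, η, hη⟩ := hs x
    exact ⟨U, hxU, c • η, fun y hy => by rw [map_smul, ← hη y hy]; rfl⟩

/-- The pullback `f^* : Γ(Y, Ω^n_{Y/k}) → Γ(X, Ω^n_{X/k})` along a morphism `f : X → Y` of
`k`-schemes; on germs it is induced by `𝒪_{Y, f x} → 𝒪_{X, x}`. -/
def pullbackForms {X Y : Over (Spec (.of k))} (f : X ⟶ Y) (n : ℕ) :
    globalForms Y n →ₗ[k] globalForms X n where
  toFun s := ⟨fun x => formsMap n (stalkHom f x) (s.1 (f.left x)), fun x => by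
    obtain ⟨U, hU, η, hη⟩ := s.2 (f.left x)
    refine ⟨f.left ⁻¹ᵁ U, hU, formsMap n (appHom f U) η, fun y hy => ?_⟩
    beta_reduce
    rw [hη _ hy, ← formsMap_comp, ← formsMap_comp]
    exact congrArg (fun φ => formsMap n φ η) (stalkHom_comp_germHom f U y hy)⟩
  map_add' s t := by ext x : 2; exact (formsMap n (stalkHom f x)).map_add _ _
  map_smul' c s := by ext x : 2; exact (formsMap n (stalkHom f x)).map_smul c _

end Schemes

section Surface

open MvPolynomial

/-- The quartic form `(y₂³ - y₁³) y₁ + (x₁³ - x₀³) x₀`; the variables `0, 1, 2, 3` stand for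
`y₂, y₁, x₁, x₀`. -/
def quartic : MvPolynomial (Fin 4) ℂ :=
  (X 0 ^ 3 - X 1 ^ 3) * X 1 + (X 2 ^ 3 - X 3 ^ 3) * X 3

theorem quartic_isHomogeneous : quartic.IsHomogeneous 4 := by
  have h (i j : Fin 4) : ((X i ^ 3 - X j ^ 3) * X j : MvPolynomial (Fin 4) ℂ).IsHomogeneous 4 :=
    (((isHomogeneous_X_pow i 3).sub (isHomogeneous_X_pow j 3)).mul (isHomogeneous_X ℂ j))
  exact (h 0 1).add (h 2 3)

/-- The homogeneous coordinate ring `ℂ[y₂, y₁, x₁, x₀] / (quartic)`. -/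
abbrev CoordRing : Type := MvPolynomial (Fin 4) ℂ ⧸ Ideal.span {quartic}

/-- The class of a polynomial in the homogeneous coordinate ring. -/
abbrev toCoordRing : MvPolynomial (Fin 4) ℂ →ₐ[ℂ] CoordRing :=
  Ideal.Quotient.mkₐ ℂ (Ideal.span {quartic})

/-- The grading by degree: the degree `n` part consists of the classes of the forms of
degree `n`. -/
def grading (n : ℕ) : Submodule ℂ CoordRing :=
  (homogeneousSubmodule (Fin 4) ℂ n).map toCoordRing.toLinearMap

theorem toCoordRing_mem {n : ℕ} {p : MvPolynomial (Fin 4) ℂ} (hp : p.IsHomogeneous n) :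
    toCoordRing p ∈ grading n :=
  ⟨p, hp, rfl⟩

instance : SetLike.GradedMonoid grading where
  one_mem := ⟨1, isHomogeneous_one _ _, map_one toCoordRing⟩
  mul_mem := by
    rintro i j _ _ ⟨p, hp, rfl⟩ ⟨q, hq, rfl⟩
    exact ⟨p * q, IsHomogeneous.mul hp hq, map_mul toCoordRing p q⟩

/-- The map from the direct sum of the spaces of forms of degree `n` to the direct sum of the
`grading n`. -/
def gradedQuotient : (DirectSum ℕ fun n => homogeneousSubmodule (Fin 4) ℂ n) →ₐ[ℂ]
    DirectSum ℕ fun n => grading n :=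
  DirectSum.toAlgebra ℂ (fun n => homogeneousSubmodule (Fin 4) ℂ n)
    (fun n => (DirectSum.lof ℂ ℕ (fun n => grading n) n).comp
      (toCoordRing.toLinearMap.restrict (p := homogeneousSubmodule (Fin 4) ℂ n)
        fun _ hp => toCoordRing_mem hp))
    (by
      refine DirectSum.of_eq_of_gradedMonoid_eq (Sigma.subtype_ext rfl ?_)
      exact map_one toCoordRing)
    (fun {i j} p q => by
      refine Eq.trans ?_ (DirectSum.of_mul_of _ _).symm
      refine DirectSum.of_eq_of_gradedMonoid_eq (Sigma.subtype_ext rfl ?_)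
      exact map_mul toCoordRing p.1 q.1)

theorem gradedQuotient_of (n : ℕ) (p : homogeneousSubmodule (Fin 4) ℂ n) :
    gradedQuotient (DirectSum.of (fun n => homogeneousSubmodule (Fin 4) ℂ n) n p) =
      DirectSum.of (fun n => grading n) n ⟨toCoordRing p.1, toCoordRing_mem p.2⟩ := by
  exact DirectSum.toAddMonoid_of (β := fun n => homogeneousSubmodule (Fin 4) ℂ n) _ n p

attribute [local instance] MvPolynomial.gradedAlgebra in
/-- The map `ℂ[y₂, y₁, x₁, x₀] → ⨁ grading n` sending a polynomial to the classes of its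
homogeneous components. -/
def components : MvPolynomial (Fin 4) ℂ →ₐ[ℂ] DirectSum ℕ fun n => grading n :=
  gradedQuotient.comp
    (DirectSum.decomposeAlgEquiv (homogeneousSubmodule (Fin 4) ℂ)).toAlgHom

attribute [local instance] MvPolynomial.gradedAlgebra in
theorem components_of_isHomogeneous {n : ℕ} {p : MvPolynomial (Fin 4) ℂ}
    (hp : p.IsHomogeneous n) : components p =
      DirectSum.of (fun n => grading n) n ⟨toCoordRing p, toCoordRing_mem hp⟩ := by
  have h : DirectSum.decomposeAlgEquiv (homogeneousSubmodule (Fin 4) ℂ) p =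
      DirectSum.of (fun n => homogeneousSubmodule (Fin 4) ℂ n) n ⟨p, hp⟩ :=
    DirectSum.decompose_of_mem _ hp
  exact (congrArg gradedQuotient h).trans (gradedQuotient_of n ⟨p, hp⟩)

theorem components_quartic : components quartic = 0 := by
  rw [components_of_isHomogeneous quartic_isHomogeneous]
  have h : toCoordRing quartic = 0 :=
    Ideal.Quotient.eq_zero_iff_mem.mpr (Ideal.subset_span rfl)
  simp only [h]
  exact map_zero (DirectSum.of (fun n => grading n) 4)

instance gradedAlgebra : GradedAlgebra grading :=
  GradedAlgebra.ofAlgHom grading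
    (Ideal.Quotient.liftₐ (Ideal.span {quartic}) components fun a ha => by
      obtain ⟨b, rfl⟩ := Ideal.mem_span_singleton'.mp ha
      rw [map_mul, components_quartic, mul_zero])
    (by
      refine Ideal.Quotient.algHom_ext _ (MvPolynomial.algHom_ext fun i => ?_)
      change DirectSum.coeAlgHom grading (components (X i)) = toCoordRing (X i)
      rw [components_of_isHomogeneous (isHomogeneous_X ℂ i), DirectSum.coeAlgHom_of])
    (by
      rintro i ⟨_, p, hp, rfl⟩
      exact components_of_isHomogeneous hp)

/-- The surface `S = V((y₂³ - y₁³) y₁ + (x₁³ - x₀³) x₀) ⊂ ℙ³` over `ℂ`, as the `ℂ`-scheme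
`Proj (ℂ[y₂, y₁, x₁, x₀] / (quartic))`. -/
def S : Over (Spec (.of ℂ)) :=
  Over.mk (Y := Proj grading) (Proj.toSpecZero grading ≫
    Spec.map (CommRingCat.ofHom (algebraMap ℂ (grading 0))))

/-- The substitution `y₂ ↦ ζ y₂, y₁ ↦ y₁, x₁ ↦ ζ x₁, x₀ ↦ x₀`. -/
def scalePoly (ζ : ℂ) : MvPolynomial (Fin 4) ℂ →ₐ[ℂ] MvPolynomial (Fin 4) ℂ :=
  aeval ![C ζ * X 0, X 1, C ζ * X 2, X 3]

theorem scalePoly_quartic (ζ : ℂ) (hζ : ζ ^ 3 = 1) : scalePoly ζ quartic = quartic := by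
  have h : (C ζ : MvPolynomial (Fin 4) ℂ) ^ 3 = 1 := by rw [← map_pow, hζ, map_one]
  simp only [scalePoly, quartic, map_add, map_mul, map_sub, map_pow, aeval_X]
  simp [mul_pow, h]

theorem scalePoly_isHomogeneous (ζ : ℂ) {n : ℕ} {p : MvPolynomial (Fin 4) ℂ}
    (hp : p.IsHomogeneous n) : (scalePoly ζ p).IsHomogeneous n := by
  have h := hp.aeval (n := 1)
    (![C ζ * X 0, X 1, C ζ * X 2, X 3] : Fin 4 → MvPolynomial (Fin 4) ℂ) (by
    intro i
    fin_cases i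
    · exact (isHomogeneous_X ℂ 0).C_mul ζ
    · exact isHomogeneous_X ℂ 1
    · exact (isHomogeneous_X ℂ 2).C_mul ζ
    · exact isHomogeneous_X ℂ 3)
  rw [one_mul] at h
  exact h

/-- For `ζ³ = 1` the substitution preserves the quartic, so it acts on the homogeneous coordinate
ring, preserving degrees. -/
def scaleHom (ζ : ℂ) (hζ : ζ ^ 3 = 1) : grading →+*ᵍ grading where
  toRingHom := (Ideal.Quotient.liftₐ (Ideal.span {quartic}) (toCoordRing.comp (scalePoly ζ))
    fun a ha => by
      obtain ⟨b, rfl⟩ := Ideal.mem_span_singleton'.mp ha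
      rw [AlgHom.comp_apply, map_mul, scalePoly_quartic ζ hζ]
      exact Ideal.Quotient.eq_zero_iff_mem.mpr
        (Ideal.mul_mem_left _ _ (Ideal.subset_span rfl))).toRingHom
  map_mem := by
    rintro n _ ⟨p, hp, rfl⟩
    exact toCoordRing_mem (scalePoly_isHomogeneous ζ hp)

theorem scaleHom_toCoordRing (ζ : ℂ) (hζ : ζ ^ 3 = 1) (p : MvPolynomial (Fin 4) ℂ) :
    scaleHom ζ hζ (toCoordRing p) = toCoordRing (scalePoly ζ p) :=
  rfl

theorem scaleHom_comp (ζ η : ℂ) (hζ : ζ ^ 3 = 1) (hη : η ^ 3 = 1) (h : ζ * η = 1) :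
    (scaleHom ζ hζ).comp (scaleHom η hη) = GradedRingHom.id grading := by
  have h1 : (scalePoly ζ).comp (scalePoly η) = AlgHom.id ℂ _ := by
    refine MvPolynomial.algHom_ext fun i => ?_
    have h2 : (C η * C ζ : MvPolynomial (Fin 4) ℂ) = 1 := by
      rw [← map_mul, mul_comm, h, map_one]
    fin_cases i <;> simp [scalePoly, ← mul_assoc, h2]
  ext x
  obtain ⟨p, rfl⟩ := Ideal.Quotient.mk_surjective x
  exact congrArg toCoordRing (DFunLike.congr_fun h1 p)

theorem scaleHom_irrelevant (ζ : ℂ) (hζ : ζ ^ 3 = 1) :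
    HomogeneousIdeal.irrelevant grading ≤
      (HomogeneousIdeal.irrelevant grading).map (scaleHom ζ hζ) := by
  have hη : ζ⁻¹ ^ 3 = 1 := by rw [inv_pow, hζ, inv_one]
  have h0 : ζ ≠ 0 := by rintro rfl; norm_num at hζ
  have h := scaleHom_comp ζ ζ⁻¹ hζ hη (mul_inv_cancel₀ h0)
  calc HomogeneousIdeal.irrelevant grading
      = ((HomogeneousIdeal.irrelevant grading).map (scaleHom ζ⁻¹ hη)).map (scaleHom ζ hζ) := by
        rw [HomogeneousIdeal.map_map, h, HomogeneousIdeal.map_id]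
    _ ≤ _ := HomogeneousIdeal.map_mono _ (by
        rw [HomogeneousIdeal.map_le_iff_le_comap, HomogeneousIdeal.irrelevant_le]
        intro i hi x hx
        exact HomogeneousIdeal.mem_irrelevant_of_mem _ hi ((scaleHom ζ⁻¹ hη).map_mem hx))

theorem awayι_scale (ζ : ℂ) (hζ : ζ ^ 3 = 1) {i : ℕ} (hi : 0 < i) {s : CoordRing}
    (hs : s ∈ grading i) :
    Proj.awayι grading (scaleHom ζ hζ s) ((scaleHom ζ hζ).map_mem hs) hi ≫
        Proj.map (scaleHom ζ hζ) (scaleHom_irrelevant ζ hζ) ≫ Proj.toSpecZero grading ≫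
        Spec.map (CommRingCat.ofHom (algebraMap ℂ (grading 0))) =
      Proj.awayι grading (scaleHom ζ hζ s) ((scaleHom ζ hζ).map_mem hs) hi ≫
        Proj.toSpecZero grading ≫ Spec.map (CommRingCat.ofHom (algebraMap ℂ (grading 0))) := by
  rw [Proj.awayι_comp_map_assoc _ _ hi _ hs, Proj.awayι_toSpecZero_assoc,
    Proj.awayι_toSpecZero_assoc, ← Spec.map_comp, ← Spec.map_comp, ← Spec.map_comp]
  congr 1
  ext r
  have h1 : scaleHom ζ hζ (algebraMap ℂ CoordRing r) = algebraMap ℂ CoordRing r :=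
    congrArg toCoordRing ((scalePoly ζ).commutes r)
  have h2 : scaleHom ζ hζ 1 = 1 := map_one _
  change Localization.mk (scaleHom ζ hζ (algebraMap ℂ CoordRing r))
    (⟨scaleHom ζ hζ 1, _⟩ : Submonoid.powers (scaleHom ζ hζ s)) =
      Localization.mk (algebraMap ℂ CoordRing r) ⟨1, _⟩
  congr 1
  exact Subtype.ext h2

/-- The endomorphism `(y₂ : y₁ : x₁ : x₀) ↦ (ζ y₂ : y₁ : ζ x₁ : x₀)` of `S`, for `ζ³ = 1`;
it is induced by the substitution on homogeneous coordinates. -/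
def scaleMap (ζ : ℂ) (hζ : ζ ^ 3 = 1) : S ⟶ S :=
  Over.homMk (Proj.map (scaleHom ζ hζ) (scaleHom_irrelevant ζ hζ)) (by
    change Proj.map _ (scaleHom_irrelevant ζ hζ) ≫ Proj.toSpecZero grading ≫ Spec.map _ =
      Proj.toSpecZero grading ≫ Spec.map _
    refine (Proj.mapAffineOpenCover _ (scaleHom_irrelevant ζ hζ)).openCover.hom_ext _ _
      fun s => ?_
    exact awayι_scale ζ hζ s.1.2 s.2.2)

theorem scaleMap_comp (ζ η : ℂ) (hζ : ζ ^ 3 = 1) (hη : η ^ 3 = 1) (h : ζ * η = 1) :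
    scaleMap ζ hζ ≫ scaleMap η hη = 𝟙 S := by
  ext1
  change Proj.map _ _ ≫ Proj.map _ _ = 𝟙 _
  rw [← Proj.map_comp, ← Proj.map_id]
  congr 1
  exact scaleHom_comp ζ η hζ hη h

/-- `ξ = exp (2πi/3)`. -/
def ξ : ℂ := Complex.exp (2 * Real.pi * Complex.I / 3)

theorem ξ_pow_three : ξ ^ 3 = 1 := by
  rw [ξ, ← Complex.exp_nat_mul, Complex.exp_eq_one_iff]
  exact ⟨1, by push_cast; ring⟩

/-- The automorphism `γ : (y₂ : y₁ : x₁ : x₀) ↦ (ξ y₂ : y₁ : ξ x₁ : x₀)` of `S`. -/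
def γ : Aut S where
  hom := scaleMap ξ ξ_pow_three
  inv := scaleMap (ξ ^ 2) (by rw [← pow_mul, mul_comm, pow_mul, ξ_pow_three, one_pow])
  hom_inv_id := scaleMap_comp _ _ _ _ (by rw [← pow_succ', ξ_pow_three])
  inv_hom_id := scaleMap_comp _ _ _ _ (by rw [← pow_succ, ξ_pow_three])

end Surface
end QuarticK3
end

/-! A smooth quartic F = 0 in projective 3-space has trivial canonical bundle, and its generator is
the Poincaré residue of the Euler form divided by F. Concretely, with homogeneous coordinates t,
contracting dtᵢ ∧ dt_a ∧ dt_b with the Euler vector field and dividing by the partial derivative of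
F in the remaining variable t_c gives, up to the sign of the permutation (i, a, b, c), a 2-form
independent of the choice of indices (`residueForm_eq`). Numerator and denominator both have degree
3, so it is also invariant under rescaling t (`residueForm_smul`). In the chart tᵢ = 1, wherever the
partial in t_c is invertible, it generates the 2-forms (`span_residueForm`), and by smoothness such
indices exist at every point (`exists_isUnit_partials`).

Local data are compared inside K = `ConeField`, the fraction field of the homogeneous coordinate
ring, which is a domain because F is irreducible. Every local ring of S embeds in K, and each local
generator maps to one and the same form `coneResidue`. This form is nonzero, as contracting it with
two explicit derivations shows (`residueForm_coordIn_ne_zero`), so 2-form germs inject into the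
2-forms of K (`coneForm_injective`). The local generators therefore glue (`exists_globalForm`). Any
other global form is g times the residue form with g regular everywhere, and g is constant because S
is integral and universally closed over ℂ (`algebraMap_sections_surjective`). Hence the dimension is
one.

For the action, γ scales the coordinates by (ξ, 1, ξ, 1). With indices (0, 1, 2) in the numerator
and 3 in the denominator, the numerator picks up ξ · 1 · ξ and the partial derivative is unchanged,
which gives ξ² (`residueForm_weights`). Since ξ² ≠ 1, this action also shows that γ is not the
identity, and γ³ = 1 then gives order 3. -/

noncomputable section
namespace QuarticK3
open AlgebraicGeometry CategoryTheory TopologicalSpace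
open scoped KaehlerDifferential

/-! ### Differential algebra of the quartic: partial derivatives and Euler forms. -/

section QuarticAlgebra

variable {R R' : Type} [CommRing R] [CommRing R']

/-- The value of the quartic form at a point with coordinates in `R`. -/
def quarticValue (t : Fin 4 → R) : R := (t 0 ^ 3 - t 1 ^ 3) * t 1 + (t 2 ^ 3 - t 3 ^ 3) * t 3

/-- The values of the partial derivatives of the quartic form. -/
def partials (t : Fin 4 → R) : Fin 4 → R :=
  ![3 * t 0 ^ 2 * t 1, t 0 ^ 3 - 4 * t 1 ^ 3, 3 * t 2 ^ 2 * t 3, t 2 ^ 3 - 4 * t 3 ^ 3]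

theorem partials_smul (r : R) (t : Fin 4 → R) (j : Fin 4) :
    partials (fun j => r * t j) j = r ^ 3 * partials t j := by
  fin_cases j <;> simp [partials] <;> ring

theorem sum_mul_partials (t : Fin 4 → R) : ∑ j, t j * partials t j = 4 * quarticValue t := by
  simp [Fin.sum_univ_four, partials, quarticValue]
  ring

variable [Algebra ℂ R] [Algebra ℂ R']

theorem aeval_quartic (t : Fin 4 → R) : MvPolynomial.aeval t quartic = quarticValue t := by
  simp [quartic, quarticValue]

theorem map_quarticValue (φ : R →ₐ[ℂ] R') (t : Fin 4 → R) :
    φ (quarticValue t) = quarticValue fun j => φ (t j) := by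
  simp [quarticValue]

theorem map_partials (φ : R →ₐ[ℂ] R') (t : Fin 4 → R) (j : Fin 4) :
    φ (partials t j) = partials (fun j => φ (t j)) j := by
  have h3 : φ 3 = 3 := map_ofNat φ 3
  have h4 : φ 4 = 4 := map_ofNat φ 4
  fin_cases j <;> simp [partials, h3, h4]

theorem sum_partials_smul_D (t : Fin 4 → R) :
    ∑ j, partials t j • KaehlerDifferential.D ℂ R (t j) =
      KaehlerDifferential.D ℂ R (quarticValue t) := by
  simp only [quarticValue, map_add, map_sub, Derivation.leibniz, Derivation.leibniz_pow,
    Fin.sum_univ_four, partials]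
  simp
  module

/-- The jacobian criterion for the quartic, over local `ℂ`-algebras. -/
theorem exists_isUnit_partials [IsLocalRing R] {t : Fin 4 → R} (ht : quarticValue t = 0)
    {i : Fin 4} (hi : IsUnit (t i)) : ∃ c, c ≠ i ∧ IsUnit (partials t c) := by
  by_contra! h
  let φ : R →ₐ[ℂ] IsLocalRing.ResidueField R := IsScalarTower.toAlgHom ℂ R _
  set v : Fin 4 → IsLocalRing.ResidueField R := fun j => φ (t j) with hv
  have hφ (r : R) (hr : ¬ IsUnit r) : φ r = 0 := (IsLocalRing.residue_eq_zero_iff r).2 hr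
  have h1 (c : Fin 4) (hc : c ≠ i) : partials v c = 0 := by
    rw [hv, ← map_partials]; exact hφ _ (h c hc)
  have hvi : v i ≠ 0 := (hi.map φ).ne_zero
  -- Euler's identity supplies the missing partial derivative, since `v i` is nonzero.
  have h2 : partials v i = 0 := by
    have h3 := sum_mul_partials v
    rw [hv, ← map_quarticValue, ht, map_zero, mul_zero, ← hv,
      Finset.sum_eq_single i (fun c _ hc => by rw [h1 c hc, mul_zero]) (by simp)] at h3
    exact (mul_eq_zero.1 h3).resolve_left hvi
  have h3 (c : Fin 4) : partials v c = 0 := by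
    by_cases hc : c = i
    · exact hc ▸ h2
    · exact h1 c hc
  have : CharZero (IsLocalRing.ResidueField R) := charZero_of_injective_algebraMap (FaithfulSMul.algebraMap_injective ℂ _)
  -- The quartic separates into two binary forms, so the partials may be treated in pairs, each pair
  -- vanishing only at the origin in characteristic 0.
  have aux (a b : IsLocalRing.ResidueField R) (h : 3 * a ^ 2 * b = 0)
      (h' : a ^ 3 - 4 * b ^ 3 = 0) : a = 0 ∧ b = 0 := by
    have : a = 0 ∨ b = 0 := by simpa using h
    rcases this with rfl | rfl
    · simpa using h'
    · simpa using h'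
  obtain ⟨h4, h5⟩ := aux _ _ (h3 0) (h3 1)
  obtain ⟨h6, h7⟩ := aux _ _ (h3 2) (h3 3)
  fin_cases i <;> contradiction

/-- The exterior product of two `1`-forms. -/
def wedge : Ω[R⁄ℂ] →ₗ[R] Ω[R⁄ℂ] →ₗ[R] ⋀[R]^2 Ω[R⁄ℂ] :=
  LinearMap.mk₂ R (fun x y => exteriorPower.ιMulti R 2 ![x, y])
    (fun x x' y => (exteriorPower.ιMulti R 2).map_vecCons_add ![y] x x')
    (fun c x y => (exteriorPower.ιMulti R 2).map_vecCons_smul ![y] c x)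
    (fun x y y' => by
      have e (z : Ω[R⁄ℂ]) : Function.update ![x, y] 1 z = ![x, z] := by
        ext i; fin_cases i <;> rfl
      simpa only [e] using (exteriorPower.ιMulti R 2).map_update_add ![x, y] 1 y y')
    (fun c x y => by
      have e (z : Ω[R⁄ℂ]) : Function.update ![x, y] 1 z = ![x, z] := by
        ext i; fin_cases i <;> rfl
      simpa only [e] using (exteriorPower.ιMulti R 2).map_update_smul ![x, y] 1 c y)

theorem wedge_apply (x y : Ω[R⁄ℂ]) : wedge x y = exteriorPower.ιMulti R 2 ![x, y] := rfl

@[simp]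
theorem wedge_self (x : Ω[R⁄ℂ]) : wedge x x = 0 :=
  (exteriorPower.ιMulti R 2).map_eq_zero_of_eq ![x, x] (i := 0) (j := 1) rfl (by decide)

theorem wedge_swap (x y : Ω[R⁄ℂ]) : wedge x y = -wedge y x := by
  have h := wedge_self (x + y)
  simp only [map_add, LinearMap.add_apply, wedge_self, zero_add, add_zero] at h
  exact eq_neg_of_add_eq_zero_right h

theorem span_wedge (s : Set Ω[R⁄ℂ]) (hs : Submodule.span R s = ⊤) :
    Submodule.span R {w | ∃ x ∈ s, ∃ y ∈ s, w = wedge x y} = ⊤ := by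
  rw [eq_top_iff, ← exteriorPower.ιMulti_span_of_span R 2 _ hs]
  refine Submodule.span_mono ?_
  rintro _ ⟨v, hv, rfl⟩
  refine ⟨v 0, hv ⟨0, rfl⟩, v 1, hv ⟨1, rfl⟩, ?_⟩
  rw [wedge_apply]
  congr 1
  ext i; fin_cases i <;> rfl

theorem formsMap_wedge_D (φ : R →ₐ[ℂ] R') (a b : R) :
    formsMap 2 φ (wedge (KaehlerDifferential.D ℂ R a) (KaehlerDifferential.D ℂ R b)) =
      wedge (KaehlerDifferential.D ℂ R' (φ a)) (KaehlerDifferential.D ℂ R' (φ b)) := by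
  have h := formsMap_ιMulti_D 2 φ ![a, b]
  have h1 (Q : Type) [CommRing Q] [Algebra ℂ Q] (f : R → Q) :
      (fun i => KaehlerDifferential.D ℂ Q (f (![a, b] i))) =
        ![KaehlerDifferential.D ℂ Q (f a), KaehlerDifferential.D ℂ Q (f b)] := by
    ext i; fin_cases i <;> rfl
  rw [h1 R' φ] at h
  rw [wedge_apply, wedge_apply, ← h]
  exact congrArg (fun v => formsMap 2 φ (exteriorPower.ιMulti R 2 v)) (h1 R id).symm

/-- The contraction of `dtᵢ ∧ dt_a ∧ dt_b` with the Euler vector field. -/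
def eulerForm (t : Fin 4 → R) (i a b : Fin 4) : ⋀[R]^2 Ω[R⁄ℂ] :=
  t i • wedge (KaehlerDifferential.D ℂ R (t a)) (KaehlerDifferential.D ℂ R (t b))
    - t a • wedge (KaehlerDifferential.D ℂ R (t i)) (KaehlerDifferential.D ℂ R (t b))
    + t b • wedge (KaehlerDifferential.D ℂ R (t i)) (KaehlerDifferential.D ℂ R (t a))

theorem formsMap_eulerForm (φ : R →ₐ[ℂ] R') (t : Fin 4 → R) (i a b : Fin 4) :
    formsMap 2 φ (eulerForm t i a b) = eulerForm (fun j => φ (t j)) i a b := by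
  simp only [eulerForm, map_add, map_sub, formsMap_smul, formsMap_wedge_D]

theorem eulerForm_swap_left (t : Fin 4 → R) (i a b : Fin 4) :
    eulerForm t a i b = -eulerForm t i a b := by
  rw [eulerForm, eulerForm, wedge_swap (KaehlerDifferential.D ℂ R (t a)) (KaehlerDifferential.D ℂ R (t i))]
  module

theorem eulerForm_swap_right (t : Fin 4 → R) (i a b : Fin 4) :
    eulerForm t i b a = -eulerForm t i a b := by
  rw [eulerForm, eulerForm, wedge_swap (KaehlerDifferential.D ℂ R (t b)) (KaehlerDifferential.D ℂ R (t a))]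
  module

/-- The terms containing dr, produced by d(r t) = r dt + t dr, cancel in the alternating sum. This
is what lets the form pass from the cone to the surface. -/
theorem eulerForm_smul (r : R) (t : Fin 4 → R) (i a b : Fin 4) :
    eulerForm (fun j => r * t j) i a b = r ^ 3 • eulerForm t i a b := by
  simp only [eulerForm, Derivation.leibniz, map_add, map_smul, LinearMap.add_apply,
    LinearMap.smul_apply, wedge_self]
  rw [wedge_swap (KaehlerDifferential.D ℂ R (t a)) (KaehlerDifferential.D ℂ R r),
    wedge_swap (KaehlerDifferential.D ℂ R (t i)) (KaehlerDifferential.D ℂ R r)]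
  module

theorem eulerForm_diag (c : Fin 4 → ℂ) (t : Fin 4 → R) (i a b : Fin 4) :
    eulerForm (fun j => algebraMap ℂ R (c j) * t j) i a b =
      algebraMap ℂ R (c i * c a * c b) • eulerForm t i a b := by
  simp only [eulerForm, Derivation.leibniz, map_smul, LinearMap.smul_apply,
    Derivation.map_algebraMap, smul_zero, add_zero, map_mul]
  module

/-- The sum is the contraction of dtᵢ ∧ dt_a ∧ dF with the Euler field; both dF and the Euler
derivative 4F vanish on the quartic. -/
theorem sum_partials_smul_eulerForm {t : Fin 4 → R} (ht : quarticValue t = 0) (i a : Fin 4) :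
    ∑ j, partials t j • eulerForm t i a j = 0 := by
  have h1 := sum_partials_smul_D t
  have h2 := sum_mul_partials t
  rw [ht] at h1 h2
  rw [map_zero] at h1
  rw [mul_zero] at h2
  have h3 (x : Ω[R⁄ℂ]) : ∑ j, partials t j • wedge x (KaehlerDifferential.D ℂ R (t j)) = 0 := by
    simpa using congrArg (wedge x) h1
  calc ∑ j, partials t j • eulerForm t i a j
      = t i • (∑ j, partials t j • wedge (KaehlerDifferential.D ℂ R (t a))
            (KaehlerDifferential.D ℂ R (t j)))
          - t a • (∑ j, partials t j • wedge (KaehlerDifferential.D ℂ R (t i))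
            (KaehlerDifferential.D ℂ R (t j)))
          + (∑ j, t j * partials t j) • wedge (KaehlerDifferential.D ℂ R (t i))
            (KaehlerDifferential.D ℂ R (t a)) := by
        simp only [Fin.sum_univ_four, eulerForm]
        module
    _ = 0 := by simp only [h2, h3, smul_zero, zero_smul, sub_zero, add_zero]

@[simp]
theorem eulerForm_self_left (t : Fin 4 → R) (i a : Fin 4) : eulerForm t i a i = 0 := by
  rw [eulerForm, wedge_self, wedge_swap (KaehlerDifferential.D ℂ R (t a))]
  module

@[simp]
theorem eulerForm_self_right (t : Fin 4 → R) (i a : Fin 4) : eulerForm t i a a = 0 := by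
  rw [eulerForm, wedge_self]
  module

/-- Only the two indices other than `σ 0` and `σ 1` survive in the preceding sum. This relation
allows the partial derivative in the denominator to be exchanged. -/
theorem partials_smul_eulerForm {t : Fin 4 → R} (ht : quarticValue t = 0)
    (σ : Equiv.Perm (Fin 4)) :
    partials t (σ 2) • eulerForm t (σ 0) (σ 1) (σ 2) =
      -(partials t (σ 3) • eulerForm t (σ 0) (σ 1) (σ 3)) := by
  have h := sum_partials_smul_eulerForm ht (σ 0) (σ 1)
  rw [← Equiv.sum_comp σ, Fin.sum_univ_four] at h
  simp only [eulerForm_self_left, eulerForm_self_right, smul_zero, zero_add] at h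
  exact eq_neg_of_add_eq_zero_left h

/-- In the affine chart the coordinate `t (σ 0)` has zero differential, and dF = 0 expresses the
differential of `t (σ 3)` through the other two. Those two span the 1-forms, so their wedge, which
is the Euler form here, spans the 2-forms. -/
theorem span_eulerForm {t : Fin 4 → R} (ht : quarticValue t = 0) (σ : Equiv.Perm (Fin 4))
    (h0 : t (σ 0) = 1) (h3 : IsUnit (partials t (σ 3)))
    (hspan : Submodule.span R (Set.range fun j => KaehlerDifferential.D ℂ R (t j)) = ⊤) :
    Submodule.span R {eulerForm t (σ 0) (σ 1) (σ 2)} = ⊤ := by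
  have hd0 : KaehlerDifferential.D ℂ R (t (σ 0)) = 0 := by rw [h0, Derivation.map_one_eq_zero]
  set x := KaehlerDifferential.D ℂ R (t (σ 1)) with hx
  set y := KaehlerDifferential.D ℂ R (t (σ 2)) with hy
  have hxy : Submodule.span R {x, y} = ⊤ := by
    rw [eq_top_iff, ← hspan, Submodule.span_le]
    rintro _ ⟨j, rfl⟩
    have hx' : x ∈ Submodule.span R {x, y} := Submodule.subset_span (by simp)
    have hy' : y ∈ Submodule.span R {x, y} := Submodule.subset_span (by simp)
    obtain ⟨j, rfl⟩ := σ.surjective j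
    have h := sum_partials_smul_D t
    rw [ht, map_zero, ← Equiv.sum_comp σ, Fin.sum_univ_four, hd0, smul_zero, zero_add, ← hx,
      ← hy] at h
    fin_cases j
    · simp [hd0]
    · exact hx'
    · exact hy'
    · refine (Submodule.smul_mem_iff_of_isUnit _ h3).1 ?_
      change partials t (σ 3) • KaehlerDifferential.D ℂ R (t (σ 3)) ∈ _
      rw [eq_neg_of_add_eq_zero_right h]
      exact neg_mem (add_mem (Submodule.smul_mem _ _ hx') (Submodule.smul_mem _ _ hy'))
  rw [eq_top_iff, ← span_wedge _ hxy, Submodule.span_le]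
  have he : eulerForm t (σ 0) (σ 1) (σ 2) = wedge x y := by
    rw [eulerForm, hd0, h0, ← hx, ← hy]
    simp
  have he' : wedge x y ∈ Submodule.span R {eulerForm t (σ 0) (σ 1) (σ 2)} := by
    rw [he]; exact Submodule.mem_span_singleton_self _
  rintro _ ⟨v, hv | hv, w, hw | hw, rfl⟩
  · rw [hv, hw, wedge_self]; exact zero_mem _
  · rw [hv, hw]; exact he'
  · rw [hv, hw, wedge_swap]; exact neg_mem he'
  · rw [hv, hw, wedge_self]; exact zero_mem _

/-- The contraction of `2`-forms with a pair of vector fields. -/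
def contract (D₁ D₂ : Derivation ℂ R R) : (⋀[R]^2 Ω[R⁄ℂ]) →ₗ[R] R :=
  exteriorPower.alternatingMapLinearEquiv (Matrix.detRowAlternating.compLinearMap
    (LinearMap.pi ![D₁.liftKaehlerDifferential, D₂.liftKaehlerDifferential]))

theorem contract_wedge_D (D₁ D₂ : Derivation ℂ R R) (a b : R) :
    contract D₁ D₂ (wedge (KaehlerDifferential.D ℂ R a) (KaehlerDifferential.D ℂ R b)) =
      D₁ a * D₂ b - D₂ a * D₁ b := by
  rw [contract, wedge_apply, exteriorPower.alternatingMapLinearEquiv_apply_ιMulti]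
  simp only [AlternatingMap.compLinearMap_apply]
  exact (Matrix.det_fin_two _).trans (by simp)

theorem contract_eulerForm (D₁ D₂ : Derivation ℂ R R) (t : Fin 4 → R) (i a b : Fin 4)
    (h₁ : D₁ (t i) = 0) (h₂ : D₂ (t i) = 0) :
    contract D₁ D₂ (eulerForm t i a b) = t i * (D₁ (t a) * D₂ (t b) - D₂ (t a) * D₁ (t b)) := by
  simp [eulerForm, contract_wedge_D, h₁, h₂]

end QuarticAlgebra

/-! ### The residue form and its independence of choices. -/

section ResidueForm

variable {F F' : Type} [CommRing F] [Algebra ℂ F] [CommRing F'] [Algebra ℂ F']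

/-- The residue of the form with a simple pole along the quartic, computed by dividing the Euler
form by one of the partial derivatives. -/
def residueForm (t : Fin 4 → F) (σ : Equiv.Perm (Fin 4)) : ⋀[F]^2 Ω[F⁄ℂ] :=
  (Equiv.Perm.sign σ : ℤ) • Ring.inverse (partials t (σ 3)) • eulerForm t (σ 0) (σ 1) (σ 2)

/-- Swapping positions inside the Euler form changes its sign; swapping positions 2 and 3 does the
same to the quotient, by the exchange relation. The sign of the permutation compensates. -/
theorem residueForm_mul_swap {t : Fin 4 → F} (ht : quarticValue t = 0)
    (hp : ∀ c, IsUnit (partials t c)) (σ : Equiv.Perm (Fin 4)) (k : Fin 3) :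
    residueForm t (σ * Equiv.swap k.castSucc k.succ) = residueForm t σ := by
  have hs : Equiv.Perm.sign (σ * Equiv.swap k.castSucc k.succ) = -Equiv.Perm.sign σ := by
    rw [Equiv.Perm.sign_mul, Equiv.Perm.sign_swap (Fin.castSucc_lt_succ).ne, mul_neg_one]
  rw [residueForm, residueForm, hs]
  rw [Units.val_neg, neg_smul, ← smul_neg]
  congr 1
  rw [neg_eq_iff_eq_neg]
  fin_cases k
  · have e0 : Equiv.swap (0 : Fin 4) 1 0 = 1 := by decide
    have e1 : Equiv.swap (0 : Fin 4) 1 1 = 0 := by decide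
    have e2 : Equiv.swap (0 : Fin 4) 1 2 = 2 := by decide
    have e3 : Equiv.swap (0 : Fin 4) 1 3 = 3 := by decide
    change Ring.inverse (partials t (σ (Equiv.swap 0 1 3))) • eulerForm t (σ (Equiv.swap 0 1 0))
      (σ (Equiv.swap 0 1 1)) (σ (Equiv.swap 0 1 2)) = _
    rw [e0, e1, e2, e3, eulerForm_swap_left, smul_neg]
  · have e0 : Equiv.swap (1 : Fin 4) 2 0 = 0 := by decide
    have e1 : Equiv.swap (1 : Fin 4) 2 1 = 2 := by decide
    have e2 : Equiv.swap (1 : Fin 4) 2 2 = 1 := by decide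
    have e3 : Equiv.swap (1 : Fin 4) 2 3 = 3 := by decide
    change Ring.inverse (partials t (σ (Equiv.swap 1 2 3))) • eulerForm t (σ (Equiv.swap 1 2 0))
      (σ (Equiv.swap 1 2 1)) (σ (Equiv.swap 1 2 2)) = _
    rw [e0, e1, e2, e3, eulerForm_swap_right, smul_neg]
  · have e0 : Equiv.swap (2 : Fin 4) 3 0 = 0 := by decide
    have e1 : Equiv.swap (2 : Fin 4) 3 1 = 1 := by decide
    have e2 : Equiv.swap (2 : Fin 4) 3 2 = 3 := by decide
    have e3 : Equiv.swap (2 : Fin 4) 3 3 = 2 := by decide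
    change Ring.inverse (partials t (σ (Equiv.swap 2 3 3))) • eulerForm t (σ (Equiv.swap 2 3 0))
      (σ (Equiv.swap 2 3 1)) (σ (Equiv.swap 2 3 2)) = _
    -- Multiplying by the unit `partials t (σ 2)` brings the goal to the exchange relation.
    rw [e0, e1, e2, e3, ← (hp (σ 2)).smul_left_cancel, smul_smul, Ring.mul_inverse_cancel _ (hp _),
      one_smul, smul_neg, smul_comm, partials_smul_eulerForm ht, smul_neg, neg_neg, smul_smul,
      Ring.inverse_mul_cancel _ (hp _), one_smul]

/-- Adjacent transpositions generate the symmetric group. All four partials must be units, which is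
available in the fraction field; charts are therefore compared there. -/
theorem residueForm_eq {t : Fin 4 → F} (ht : quarticValue t = 0)
    (hp : ∀ c, IsUnit (partials t c)) (σ : Equiv.Perm (Fin 4)) :
    residueForm t σ = residueForm t 1 := by
  have hσ : σ ∈ Submonoid.closure
      (Set.range fun i : Fin 3 => Equiv.swap i.castSucc i.succ) := by
    rw [Equiv.Perm.mclosure_swap_castSucc_succ]; trivial
  induction hσ using Submonoid.closure_induction_right with
  | one => rfl
  | mul_right x _ y hy ih =>
    obtain ⟨k, rfl⟩ := hy
    rw [residueForm_mul_swap ht hp, ih]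

/-- Both the Euler form and the partials are homogeneous of degree 3; this numerical coincidence is
the triviality of the canonical bundle of a quartic. -/
theorem residueForm_smul {r : F} (hr : IsUnit r) (t : Fin 4 → F) (σ : Equiv.Perm (Fin 4)) :
    residueForm (fun j => r * t j) σ = residueForm t σ := by
  rw [residueForm, residueForm, eulerForm_smul, partials_smul, Ring.mul_inverse_rev, smul_smul,
    mul_assoc, Ring.inverse_mul_cancel _ (hr.pow 3), mul_one]

theorem map_ringInverse (φ : F →ₐ[ℂ] F') {a : F} (ha : IsUnit a) :
    φ (Ring.inverse a) = Ring.inverse (φ a) := by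
  rw [← (ha.map φ).mul_right_inj, ← map_mul, Ring.mul_inverse_cancel _ ha,
    Ring.mul_inverse_cancel _ (ha.map φ), map_one]

theorem formsMap_residueForm (φ : F →ₐ[ℂ] F') (t : Fin 4 → F) (σ : Equiv.Perm (Fin 4))
    (hp : IsUnit (partials t (σ 3))) :
    formsMap 2 φ (residueForm t σ) = residueForm (fun j => φ (t j)) σ := by
  rw [residueForm, residueForm, map_zsmul, formsMap_smul, formsMap_eulerForm,
    map_ringInverse φ hp, map_partials]

theorem span_residueForm {t : Fin 4 → F} (ht : quarticValue t = 0) (σ : Equiv.Perm (Fin 4))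
    (h0 : t (σ 0) = 1) (h3 : IsUnit (partials t (σ 3)))
    (hspan : Submodule.span F (Set.range fun j => KaehlerDifferential.D ℂ F (t j)) = ⊤) :
    Submodule.span F {residueForm t σ} = ⊤ := by
  have hu : IsUnit (((Equiv.Perm.sign σ : ℤ) : F) * Ring.inverse (partials t (σ 3))) :=
    ((Equiv.Perm.sign σ).isUnit.map (Int.castRingHom F)).mul h3.ringInverse
  have h : residueForm t σ = (((Equiv.Perm.sign σ : ℤ) : F) * Ring.inverse (partials t (σ 3))) •
      eulerForm t (σ 0) (σ 1) (σ 2) := by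
    rw [residueForm, mul_smul, Int.cast_smul_eq_zsmul]
  rw [h, Submodule.span_singleton_smul_eq hu, span_eulerForm ht σ h0 h3 hspan]

end ResidueForm

/-! ### Irreducibility of the quartic. -/

section Integrality

/-- The leading coefficient p is prime, so one factor has unit leading coefficient and keeps its
degree modulo p. Modulo p the product is a nonzero constant, so that factor is constant, hence a
unit. -/
theorem irreducible_C_mul_X_pow_add_C {B : Type} [CommRing B] [IsDomain B] {p c : B}
    (hp : Prime p) (hc : ¬ p ∣ c) {n : ℕ} (hn : 0 < n) :
    Irreducible (Polynomial.C p * Polynomial.X ^ n + Polynomial.C c) := by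
  have hdeg : (Polynomial.C p * Polynomial.X ^ n + Polynomial.C c).natDegree = n := by
    rw [Polynomial.natDegree_add_C, Polynomial.natDegree_C_mul_X_pow n p hp.ne_zero]
  have hlead : (Polynomial.C p * Polynomial.X ^ n + Polynomial.C c).leadingCoeff = p := by
    rw [Polynomial.leadingCoeff, hdeg]
    simp [Polynomial.coeff_C, hn.ne']
  have key (g h : Polynomial B) (hgh : Polynomial.C p * Polynomial.X ^ n + Polynomial.C c = g * h)
      (hg : IsUnit g.leadingCoeff) : IsUnit g := by
    let φ := Ideal.Quotient.mk (Ideal.span {p})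
    have : (Ideal.span {p}).IsPrime := (Ideal.span_singleton_prime hp.ne_zero).2 hp
    have h1 := congrArg (Polynomial.map φ) hgh
    have hp0 : φ p = 0 := Ideal.Quotient.eq_zero_iff_mem.2 (Ideal.mem_span_singleton_self p)
    have hc0 : φ c ≠ 0 := fun h => hc (Ideal.mem_span_singleton.1 (Ideal.Quotient.eq_zero_iff_mem.1 h))
    simp only [Polynomial.map_add, Polynomial.map_mul, Polynomial.map_C, hp0, map_zero, zero_mul,
      zero_add] at h1
    have h2 : Polynomial.map φ g * Polynomial.map φ h ≠ 0 := by
      rw [← h1]; simpa using hc0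
    have h3 := congrArg Polynomial.natDegree h1
    rw [Polynomial.natDegree_C, Polynomial.natDegree_mul (left_ne_zero_of_mul h2)
      (right_ne_zero_of_mul h2)] at h3
    have h4 : g.natDegree = 0 := by
      rw [← Polynomial.natDegree_map_of_leadingCoeff_ne_zero φ (hg.map φ).ne_zero]
      omega
    rw [Polynomial.eq_C_of_natDegree_eq_zero h4, Polynomial.isUnit_C]
    rwa [Polynomial.leadingCoeff, h4] at hg
  refine ⟨fun h => ?_, fun g h hgh => ?_⟩
  · rw [Polynomial.natDegree_eq_zero_of_isUnit h] at hdeg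
    omega
  · have h1 : p = g.leadingCoeff * h.leadingCoeff := by
      rw [← Polynomial.leadingCoeff_mul, ← hgh, hlead]
    rcases hp.irreducible.isUnit_or_isUnit h1 with h2 | h2
    · exact Or.inl (key g h hgh h2)
    · exact Or.inr (key h g (hgh.trans (mul_comm _ _)) h2)

theorem quartic_irreducible : Irreducible quartic := by
  rw [← MulEquiv.irreducible_iff (MvPolynomial.finSuccEquiv ℂ 3)]
  set x : Fin 3 → MvPolynomial (Fin 3) ℂ := MvPolynomial.X with hx
  -- As a polynomial in y₂ the quartic has the shape of the preceding criterion, with prime leading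
  -- coefficient y₁.
  have h1 : MvPolynomial.finSuccEquiv ℂ 3 quartic = Polynomial.C (x 0) * Polynomial.X ^ 3 +
      Polynomial.C ((x 1 ^ 3 - x 2 ^ 3) * x 2 - x 0 ^ 4) := by
    have e1 : MvPolynomial.finSuccEquiv ℂ 3 (MvPolynomial.X 1) = Polynomial.C (x 0) :=
      MvPolynomial.finSuccEquiv_X_succ (j := 0)
    have e2 : MvPolynomial.finSuccEquiv ℂ 3 (MvPolynomial.X 2) = Polynomial.C (x 1) :=
      MvPolynomial.finSuccEquiv_X_succ (j := 1)
    have e3 : MvPolynomial.finSuccEquiv ℂ 3 (MvPolynomial.X 3) = Polynomial.C (x 2) :=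
      MvPolynomial.finSuccEquiv_X_succ (j := 2)
    simp only [quartic, map_add, map_mul, map_sub, map_pow, MvPolynomial.finSuccEquiv_X_zero, e1,
      e2, e3]
    ring
  rw [h1]
  refine irreducible_C_mul_X_pow_add_C (MvPolynomial.X_prime) ?_ (by norm_num)
  rintro ⟨q, hq⟩
  -- At this point y₁ vanishes while the constant term is -1.
  have := congrArg (MvPolynomial.aeval (![0, 0, 1] : Fin 3 → ℂ)) hq
  simp [hx] at this

instance : IsDomain CoordRing := by
  have : (Ideal.span {quartic}).IsPrime :=
    (Ideal.span_singleton_prime quartic_irreducible.ne_zero).2 quartic_irreducible.prime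
  infer_instance

/-- A nonzero multiple of the quartic has degree at least 4. -/
theorem toCoordRing_ne_zero {p : MvPolynomial (Fin 4) ℂ} {n : ℕ} (hp : p.IsHomogeneous n)
    (hn : n < 4) (h0 : p ≠ 0) : toCoordRing p ≠ 0 := by
  intro h
  obtain ⟨q, rfl⟩ := Ideal.mem_span_singleton.1 (Ideal.Quotient.eq_zero_iff_mem.1 h)
  have h1 := hp.totalDegree h0
  have h2 := quartic_isHomogeneous.totalDegree (left_ne_zero_of_mul h0)
  rw [MvPolynomial.totalDegree_mul_of_isDomain (left_ne_zero_of_mul h0)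
    (right_ne_zero_of_mul h0)] at h1
  omega

/-- The homogeneous coordinates. -/
def coord (i : Fin 4) : CoordRing := toCoordRing (MvPolynomial.X i)

theorem coord_mem (i : Fin 4) : coord i ∈ grading 1 :=
  toCoordRing_mem (MvPolynomial.isHomogeneous_X ℂ i)

theorem coord_ne_zero (i : Fin 4) : coord i ≠ 0 :=
  toCoordRing_ne_zero (MvPolynomial.isHomogeneous_X ℂ i) (by norm_num) (MvPolynomial.X_ne_zero i)

theorem partials_coord_ne_zero (c : Fin 4) : partials coord c ≠ 0 := by
  have h (c : Fin 4) : partials coord c = toCoordRing (partials MvPolynomial.X c) := by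
    rw [map_partials]; rfl
  have hhom (c : Fin 4) :
      (partials (MvPolynomial.X : Fin 4 → MvPolynomial (Fin 4) ℂ) c).IsHomogeneous 3 := by
    have h1 (a b : Fin 4) : (3 * MvPolynomial.X a ^ 2 * MvPolynomial.X b :
        MvPolynomial (Fin 4) ℂ).IsHomogeneous 3 := by
      have := ((MvPolynomial.isHomogeneous_X_pow (R := ℂ) a 2).mul
        (MvPolynomial.isHomogeneous_X ℂ b)).C_mul 3
      rwa [map_ofNat, ← mul_assoc] at this
    have h2 (a b : Fin 4) : (MvPolynomial.X a ^ 3 - 4 * MvPolynomial.X b ^ 3 :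
        MvPolynomial (Fin 4) ℂ).IsHomogeneous 3 := by
      have := (MvPolynomial.isHomogeneous_X_pow (R := ℂ) a 3).sub
        ((MvPolynomial.isHomogeneous_X_pow (R := ℂ) b 3).C_mul 4)
      rwa [map_ofNat] at this
    fin_cases c
    · exact h1 0 1
    · exact h2 0 1
    · exact h1 2 3
    · exact h2 2 3
  rw [h]
  refine toCoordRing_ne_zero (hhom c) (by norm_num) fun h0 => ?_
  have := congrArg (MvPolynomial.aeval fun _ => (1 : ℂ)) h0
  rw [map_partials, map_zero] at this
  fin_cases c <;> norm_num [partials] at this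

theorem quarticValue_coord : quarticValue coord = 0 := by
  have h : quarticValue coord = toCoordRing quartic := by
    simp only [quarticValue, quartic, coord, map_add, map_sub, map_mul, map_pow]
  rw [h]
  exact Ideal.Quotient.eq_zero_iff_mem.mpr (Ideal.subset_span rfl)

end Integrality

/-! ### Embedding the local rings in one field; global functions. -/

section FunctionField

/-- The fraction field of the homogeneous coordinate ring. -/
abbrev ConeField : Type := FractionRing CoordRing

/-- The local rings of the homogeneous coordinate ring are subrings of its fraction field. -/
def localizationToConeField (p : Ideal CoordRing) [p.IsPrime] :
    Localization.AtPrime p →+* ConeField :=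
  IsLocalization.lift (M := p.primeCompl) (g := algebraMap CoordRing ConeField) fun s =>
    IsLocalization.map_units ConeField
      (⟨s, p.primeCompl_le_nonZeroDivisors s.2⟩ : nonZeroDivisors CoordRing)

theorem localizationToConeField_mk' (p : Ideal CoordRing) [p.IsPrime] (a : CoordRing)
    (s : p.primeCompl) :
    localizationToConeField p (IsLocalization.mk' (Localization.AtPrime p) a s) =
      algebraMap CoordRing ConeField a / algebraMap CoordRing ConeField s := by
  have hs : algebraMap CoordRing ConeField s ≠ 0 :=
    (IsLocalization.map_units ConeField
      (⟨s, p.primeCompl_le_nonZeroDivisors s.2⟩ : nonZeroDivisors CoordRing)).ne_zero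
  rw [localizationToConeField, IsLocalization.lift_mk'_spec, mul_div_cancel₀ _ hs]

theorem localizationToConeField_injective (p : Ideal CoordRing) [p.IsPrime] :
    Function.Injective (localizationToConeField p) := by
  rw [injective_iff_map_eq_zero]
  intro z hz
  obtain ⟨a, s, rfl⟩ := IsLocalization.exists_mk'_eq p.primeCompl z
  have hs : algebraMap CoordRing ConeField s ≠ 0 :=
    (IsLocalization.map_units ConeField
      (⟨s, p.primeCompl_le_nonZeroDivisors s.2⟩ : nonZeroDivisors CoordRing)).ne_zero
  rw [localizationToConeField_mk', div_eq_zero_iff, or_iff_left hs,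
    map_eq_zero_iff _ (IsFractionRing.injective CoordRing ConeField)] at hz
  rw [hz, IsLocalization.mk'_zero]

/-- The local rings of `S` are subrings of the fraction field of the homogeneous coordinate
ring. -/
def stalkToConeField (x : S.left) : S.left.presheaf.stalk x →+* ConeField :=
  let p : ProjectiveSpectrum grading := x
  ((localizationToConeField p.asHomogeneousIdeal.toIdeal).comp
    (algebraMap (HomogeneousLocalization.AtPrime grading p.asHomogeneousIdeal.toIdeal)
      (Localization.AtPrime p.asHomogeneousIdeal.toIdeal))).comp
    (Proj.stalkIso' grading p).toRingHom

theorem stalkToConeField_injective (x : S.left) : Function.Injective (stalkToConeField x) := by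
  let p : ProjectiveSpectrum grading := x
  exact ((localizationToConeField_injective p.asHomogeneousIdeal.toIdeal).comp
    (HomogeneousLocalization.val_injective p.asHomogeneousIdeal.toIdeal.primeCompl)).comp
    (Proj.stalkIso' grading p).injective

theorem stalkToConeField_germ (x : S.left) {i : ℕ} {f : CoordRing} (hf : f ∈ grading i)
    (hx : x ∈ Proj.basicOpen grading f) (n : ℕ) (a : CoordRing) (ha : a ∈ grading (n • i)) :
    stalkToConeField x (S.left.presheaf.germ (Proj.basicOpen grading f) x hx
      ((Proj.awayToSection grading f).hom
        (HomogeneousLocalization.Away.mk grading hf n a ha))) =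
      algebraMap CoordRing ConeField a / algebraMap CoordRing ConeField f ^ n := by
  let p : ProjectiveSpectrum grading := x
  set z := HomogeneousLocalization.Away.mk grading hf n a ha with hz
  have h1 : Proj.stalkIso' grading p (S.left.presheaf.germ (Proj.basicOpen grading f) x hx
      ((Proj.awayToSection grading f).hom z)) =
      ((Proj.awayToSection grading f).hom z).1 ⟨p, hx⟩ :=
    Proj.stalkIso'_germ grading (Proj.basicOpen grading f) p hx _
  have h2 := ProjectiveSpectrum.Proj.awayToSection_apply (𝒜 := grading) f z ⟨p, hx⟩
  change localizationToConeField p.asHomogeneousIdeal.toIdeal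
      (HomogeneousLocalization.val (Proj.stalkIso' grading p _)) = _
  rw [h1]
  refine (congrArg _ h2).trans ?_
  rw [hz, HomogeneousLocalization.Away.val_mk, Localization.mk_eq_mk', IsLocalization.map_mk',
    ← map_pow]
  exact localizationToConeField_mk' p.asHomogeneousIdeal.toIdeal _ _

/-- The zero ideal is a relevant homogeneous prime, and its closure is the whole space. -/
instance : IrreducibleSpace S.left := by
  let g : ProjectiveSpectrum grading := ⟨⊥, Ideal.isPrime_bot, fun h => coord_ne_zero 0 (by
    exact h (HomogeneousIdeal.mem_irrelevant_of_mem _ one_pos (coord_mem 0)))⟩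
  have h : closure {g} = Set.univ := by
    rw [Set.eq_univ_iff_forall]
    intro x
    rw [← ProjectiveSpectrum.le_iff_mem_closure]
    exact bot_le (a := x.asHomogeneousIdeal)
  exact (irreducibleSpace_def _).2 (Set.top_eq_univ ▸ h ▸ isIrreducible_singleton.closure)

instance : IsIntegral S.left := by
  have : IsReduced S.left := by
    have (x : S.left) : _root_.IsReduced (S.left.presheaf.stalk x) :=
      isReduced_of_injective _ (stalkToConeField_injective x)
    exact isReduced_of_isReduced_stalk _
  exact isIntegral_of_irreducibleSpace_of_isReduced _

theorem algebraMap_grading_zero_surjective :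
    Function.Surjective (algebraMap ℂ (grading 0)) := by
  rintro ⟨_, p, hp, rfl⟩
  obtain ⟨c, rfl⟩ : ∃ c, p = MvPolynomial.C c :=
    ⟨_, MvPolynomial.totalDegree_eq_zero_iff_eq_C.1 ((MvPolynomial.totalDegree_zero_iff_isHomogeneous _).2 hp)⟩
  exact ⟨c, rfl⟩

/-- Universal closedness over ℂ makes the global functions integral over ℂ. They form a domain, and
ℂ is algebraically closed. -/
theorem algebraMap_sections_surjective : Function.Surjective (algebraMap ℂ Γ(S.left, ⊤)) := by
  have : Algebra.FiniteType (grading 0) CoordRing := by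
    have : IsScalarTower ℂ (grading 0) CoordRing := ⟨fun a b c => by
      change (a • b : CoordRing) * c = a • ((b : CoordRing) * c)
      rw [smul_mul_assoc]⟩
    exact Algebra.FiniteType.of_restrictScalars_finiteType ℂ _ _
  have : IsClosedImmersion (Spec.map (CommRingCat.ofHom (algebraMap ℂ (grading 0)))) :=
    IsClosedImmersion.spec_of_surjective _ algebraMap_grading_zero_surjective
  have : UniversallyClosed S.hom := by
    change UniversallyClosed (Proj.toSpecZero grading ≫ _)
    infer_instance
  have h := isIntegral_appTop_of_universallyClosed S.hom
  have h1 : (algebraMap ℂ Γ(S.left, ⊤)).IsIntegral := by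
    change (((Scheme.ΓSpecIso (.of ℂ)).inv ≫ S.hom.appLE ⊤ ⊤ le_top).hom).IsIntegral
    have h2 : S.hom.appLE ⊤ ⊤ le_top = S.hom.appTop := Scheme.Hom.appLE_eq_app _
    rw [h2, CommRingCat.hom_comp]
    refine RingHom.IsIntegral.trans _ _ (RingHom.isIntegral_of_surjective _ ?_) h
    exact (Scheme.ΓSpecIso (.of ℂ)).symm.commRingCatIsoToRingEquiv.surjective
  have : Algebra.IsIntegral ℂ Γ(S.left, ⊤) := ⟨h1⟩
  exact (IsAlgClosed.algebraMap_bijective_of_isIntegral).2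

end FunctionField

/-! ### Vector fields on the cone and nonvanishing of the residue form. -/

section Derivations

/-- First-order Taylor expansion: F(X + εv) = F(X) + ε dF(v). -/
theorem quarticValue_dualNumber {L : Type} [CommRing L] {X v : Fin 4 → L}
    (hX : quarticValue X = 0) (hv : ∑ j, partials X j * v j = 0) :
    quarticValue (fun j => (TrivSqZeroExt.inl (X j) + TrivSqZeroExt.inr (v j) : DualNumber L)) =
      0 := by
  rw [Fin.sum_univ_four] at hv
  simp only [partials, Matrix.cons_val] at hv
  ext
  · simpa [quarticValue] using hX
  · simp [quarticValue]
    linear_combination hv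

/-- The homogeneous coordinates as elements of a fraction field of the coordinate ring. -/
def coordIn (L : Type) [Field L] [Algebra CoordRing L] (j : Fin 4) : L :=
  algebraMap CoordRing L (coord j)

variable {L : Type} [Field L] [Algebra CoordRing L]

theorem coordIn_ne_zero [IsFractionRing CoordRing L] (i : Fin 4) : coordIn L i ≠ 0 := fun h =>
  coord_ne_zero i (IsFractionRing.injective CoordRing L (h.trans (map_zero _).symm))

variable [Algebra ℂ L] [IsScalarTower ℂ CoordRing L]

theorem quarticValue_coordIn : quarticValue (coordIn L) = 0 := by
  have h := map_quarticValue (IsScalarTower.toAlgHom ℂ CoordRing L) coord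
  rw [quarticValue_coord, map_zero] at h
  exact h.symm

variable [IsFractionRing CoordRing L]

theorem partials_coordIn_ne_zero (c : Fin 4) : partials (coordIn L) c ≠ 0 := by
  have h := map_partials (IsScalarTower.toAlgHom ℂ CoordRing L) coord c
  refine fun h0 => partials_coord_ne_zero c (IsFractionRing.injective CoordRing L ?_)
  rw [map_zero]
  exact h.trans h0

/-- A tangent vector of the cone at its generic point gives a homomorphism to the dual numbers. -/
theorem exists_algHom_dualNumber {v : Fin 4 → L} (hv : ∑ j, partials (coordIn L) j * v j = 0) :
    ∃ φ : L →ₐ[ℂ] DualNumber L,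
      (∀ a, (φ a).fst = a) ∧ ∀ j, (φ (coordIn L j)).snd = v j := by
  let t : Fin 4 → DualNumber L := fun j => .inl (coordIn L j) + .inr (v j)
  have ht : quarticValue t = 0 := quarticValue_dualNumber quarticValue_coordIn hv
  let φ₀ : CoordRing →ₐ[ℂ] DualNumber L :=
    Ideal.Quotient.liftₐ (Ideal.span {quartic}) (MvPolynomial.aeval t) fun a ha => by
      obtain ⟨b, rfl⟩ := Ideal.mem_span_singleton'.mp ha
      rw [map_mul, aeval_quartic, ht, mul_zero]
  have hφ₀ (j : Fin 4) : φ₀ (coord j) = t j := MvPolynomial.aeval_X t j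
  have hfst (a : CoordRing) : (φ₀ a).fst = algebraMap CoordRing L a := by
    have h : (TrivSqZeroExt.fstHom ℂ L L).comp φ₀ = IsScalarTower.toAlgHom ℂ CoordRing L := by
      refine Ideal.Quotient.algHom_ext _ (MvPolynomial.algHom_ext fun j => ?_)
      refine (congrArg TrivSqZeroExt.fst (hφ₀ j)).trans ?_
      simp only [t, TrivSqZeroExt.fst_add, TrivSqZeroExt.fst_inl, TrivSqZeroExt.fst_inr, add_zero]
      rfl
    exact DFunLike.congr_fun h a
  -- A dual number is invertible as soon as its real part is, so the map extends to the fraction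
  -- field.
  have hunit (y : nonZeroDivisors CoordRing) : IsUnit (φ₀ y) := by
    rw [TrivSqZeroExt.isUnit_iff_isUnit_fst, hfst]
    exact IsLocalization.map_units L y
  let φ : L →ₐ[ℂ] DualNumber L :=
    IsLocalization.liftAlgHom (M := nonZeroDivisors CoordRing) (f := φ₀) hunit
  have hφ (a : CoordRing) : φ (algebraMap CoordRing L a) = φ₀ a :=
    IsLocalization.lift_eq _ a
  refine ⟨φ, fun a => ?_, fun j => ?_⟩
  · have h : (TrivSqZeroExt.fstHom ℂ L L).toRingHom.comp φ.toRingHom = RingHom.id L := by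
      refine IsLocalization.ringHom_ext (nonZeroDivisors CoordRing) (RingHom.ext fun a => ?_)
      exact (congrArg TrivSqZeroExt.fst (hφ a)).trans (hfst a)
    exact DFunLike.congr_fun h a
  · rw [coordIn, hφ, hφ₀]
    simp [t]

theorem exists_derivation {v : Fin 4 → L} (hv : ∑ j, partials (coordIn L) j * v j = 0) :
    ∃ δ : Derivation ℂ L L, ∀ j, δ (coordIn L j) = v j := by
  obtain ⟨φ, h1, h2⟩ := exists_algHom_dualNumber hv
  refine ⟨Derivation.mk' ((TrivSqZeroExt.sndHom L L).restrictScalars ℂ ∘ₗ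
    φ.toLinearMap) fun a b => ?_, h2⟩
  change (φ (a * b)).snd = a • (φ b).snd + b • (φ a).snd
  rw [map_mul, TrivSqZeroExt.snd_mul, h1, h1]
  simp [mul_comm]

/-- Contract with two vector fields that fix coordinate 0 and move coordinates 1 and 2
independently; tangency to the cone dictates their last component. The result is coordinate 0
divided by the last partial derivative. -/
theorem residueForm_coordIn_ne_zero : residueForm (coordIn L) 1 ≠ 0 := by
  have hp : partials (coordIn L) 3 ≠ 0 := partials_coordIn_ne_zero 3
  have h0 : coordIn L 0 ≠ 0 := coordIn_ne_zero 0
  obtain ⟨δ₁, h₁⟩ := exists_derivation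
    (v := ![0, 1, 0, -partials (coordIn L) 1 / partials (coordIn L) 3]) (by
      rw [Fin.sum_univ_four]
      simp only [Matrix.cons_val]
      field_simp
      ring)
  obtain ⟨δ₂, h₂⟩ := exists_derivation
    (v := ![0, 0, 1, -partials (coordIn L) 2 / partials (coordIn L) 3]) (by
      rw [Fin.sum_univ_four]
      simp only [Matrix.cons_val]
      field_simp
      ring)
  intro h
  have h3 := congrArg (contract δ₁ δ₂) h
  rw [residueForm, map_zsmul, map_smul, Equiv.Perm.one_apply, Equiv.Perm.one_apply,
    Equiv.Perm.one_apply, Equiv.Perm.one_apply, contract_eulerForm _ _ _ _ _ _ (h₁ 0) (h₂ 0),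
    map_zero, h₁, h₁, h₂, h₂] at h3
  simp [hp, h0] at h3

end Derivations

/-! ### Affine charts and generators of the 1-forms at each point. -/

section Charts

/-- The standard affine chart where the `i`-th homogeneous coordinate does not vanish. -/
def chart (i : Fin 4) : S.left.Opens := Proj.basicOpen grading (coord i)

theorem adjoin_coord : Algebra.adjoin ℂ (Set.range coord) = ⊤ := by
  have h := congrArg (Subalgebra.map toCoordRing)
    (MvPolynomial.adjoin_range_X (R := ℂ) (σ := Fin 4))
  rw [AlgHom.map_adjoin, ← Set.range_comp, Algebra.map_top, (AlgHom.range_eq_top _).2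
    (Ideal.Quotient.mkₐ_surjective _ _)] at h
  exact h

theorem exists_mem_chart (x : S.left) : ∃ i, x ∈ chart i := by
  have h : ⨆ i, Proj.basicOpen grading (coord i) = ⊤ := by
    refine Proj.iSup_basicOpen_eq_top' grading coord (fun i => ⟨1, coord_mem i⟩) ?_
    rw [eq_top_iff]
    intro a _
    have ha : a ∈ Algebra.adjoin ℂ (Set.range coord) := adjoin_coord ▸ Algebra.mem_top
    induction ha using Algebra.adjoin_induction with
    | mem a ha => exact Algebra.subset_adjoin ha
    | algebraMap r => exact Subalgebra.algebraMap_mem _ (algebraMap ℂ (grading 0) r)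
    | add a b _ _ ha hb => exact add_mem (ha trivial) (hb trivial)
    | mul a b _ _ ha hb => exact mul_mem (ha trivial) (hb trivial)
  exact Opens.mem_iSup.1 (h.ge (Set.mem_univ x))

/-- A morphism to an affine scheme is determined by its map on global sections. This identifies the
ℂ-algebra structure on a chart. -/
theorem appLE_eq_of_ι_comp {X : Scheme} {R : CommRingCat} (f : X ⟶ Spec R) (U : X.Opens)
    (φ : R ⟶ Γ(X, U)) (h : U.ι ≫ f = U.toSpecΓ ≫ Spec.map φ) :
    (Scheme.ΓSpecIso R).inv ≫ f.appLE ⊤ U le_top = φ := by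
  have h1 := congrArg Scheme.Hom.appTop h
  rw [Scheme.Hom.comp_appTop, Scheme.Hom.comp_appTop, Scheme.Opens.toSpecΓ_appTop] at h1
  rw [← cancel_mono U.topIso.inv, Category.assoc]
  have h2 : f.appLE ⊤ U le_top ≫ U.topIso.inv = f.appTop ≫ U.ι.appTop := by
    exact (Category.assoc _ _ _).trans
      (congrArg (f.appTop ≫ ·) (X.presheaf.map_comp _ _).symm)
  rw [h2, h1, ← Scheme.ΓSpecIso_inv_naturality_assoc, Iso.inv_hom_id_assoc]

theorem algebraMap_chart (i : Fin 4) (c : ℂ) :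
    algebraMap ℂ Γ(S.left, chart i) c = (Proj.awayToSection grading (coord i)).hom
      (HomogeneousLocalization.Away.mk grading (coord_mem i) 0 (algebraMap ℂ CoordRing c)
        (by rw [zero_smul]; exact SetLike.algebraMap_mem_graded grading c)) := by
  have h := appLE_eq_of_ι_comp S.hom (chart i) (CommRingCat.ofHom (algebraMap ℂ (grading 0)) ≫
    CommRingCat.ofHom (HomogeneousLocalization.fromZeroRingHom grading _) ≫
      Proj.awayToSection grading (coord i)) (by
    have h := Proj.awayι_toSpecZero grading (coord i) (coord_mem i) one_pos
    rw [Proj.awayι, Category.assoc, Iso.inv_comp_eq, Proj.basicOpenIsoSpec_hom,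
      Proj.basicOpenToSpec] at h
    have h2 := congrArg (· ≫ Spec.map (CommRingCat.ofHom (algebraMap ℂ (grading 0)))) h
    simp only [Category.assoc, ← Spec.map_comp] at h2
    exact h2)
  refine (congrArg (fun φ => φ.hom c) h).trans ?_
  refine congrArg (Proj.awayToSection grading (coord i)).hom ?_
  apply HomogeneousLocalization.val_injective
  rw [HomogeneousLocalization.Away.val_mk]
  exact congrArg (Localization.mk (algebraMap ℂ CoordRing c)) (Subtype.ext (pow_zero _).symm)

theorem stalkToConeField_algebraMap (x : S.left) (c : ℂ) :
    stalkToConeField x (algebraMap ℂ _ c) = algebraMap ℂ ConeField c := by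
  obtain ⟨i, hi⟩ := exists_mem_chart x
  rw [← (germHom S (chart i) x hi).commutes, algebraMap_chart]
  refine (stalkToConeField_germ x (coord_mem i) hi 0 _ _).trans ?_
  rw [pow_zero, div_one, ← IsScalarTower.algebraMap_apply]

/-- The local rings of `S` as subalgebras of the fraction field of the homogeneous coordinate
ring. -/
def stalkToCone (x : S.left) : S.left.presheaf.stalk x →ₐ[ℂ] ConeField where
  toRingHom := stalkToConeField x
  commutes' := stalkToConeField_algebraMap x

theorem stalkToCone_injective (x : S.left) : Function.Injective (stalkToCone x) :=
  stalkToConeField_injective x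

/-- The affine coordinate `Xⱼ / Xᵢ` on the `i`-th chart. -/
def ratio (i j : Fin 4) : Γ(S.left, chart i) :=
  (Proj.awayToSection grading (coord i)).hom
    (HomogeneousLocalization.Away.mk grading (coord_mem i) 1 (coord j)
      (by rw [one_smul]; exact coord_mem j))

theorem stalkToCone_ratio {x : S.left} {i : Fin 4} (hx : x ∈ chart i) (j : Fin 4) :
    stalkToCone x (germHom S (chart i) x hx (ratio i j)) =
      (coordIn ConeField i)⁻¹ * coordIn ConeField j := by
  refine (stalkToConeField_germ x (coord_mem i) hx 1 _ _).trans ?_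
  rw [pow_one, div_eq_inv_mul]
  rfl

theorem aeval_mul_of_isHomogeneous {R : Type} [CommRing R] [Algebra ℂ R] {n : ℕ}
    {p : MvPolynomial (Fin 4) ℂ} (hp : p.IsHomogeneous n) (r : R) (t : Fin 4 → R) :
    MvPolynomial.aeval (fun j => r * t j) p = r ^ n * MvPolynomial.aeval t p := by
  rw [MvPolynomial.aeval_def, MvPolynomial.aeval_def, MvPolynomial.eval₂_eq',
    MvPolynomial.eval₂_eq', Finset.mul_sum]
  refine Finset.sum_congr rfl fun d hd => ?_
  have h : ∑ j, d j = n := by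
    rw [← Finsupp.degree_eq_sum, Finsupp.degree_eq_weight_one]
    exact hp (MvPolynomial.mem_support_iff.1 hd)
  simp only [mul_pow, Finset.prod_mul_distrib, Finset.prod_pow_eq_pow_sum, h]
  ring

theorem stalkToCone_aeval_ratio {x : S.left} {i : Fin 4} (hx : x ∈ chart i) {n : ℕ}
    {p : MvPolynomial (Fin 4) ℂ} (hp : p.IsHomogeneous n) :
    stalkToCone x (MvPolynomial.aeval (fun j => germHom S (chart i) x hx (ratio i j)) p) =
      (coordIn ConeField i)⁻¹ ^ n * algebraMap CoordRing ConeField (toCoordRing p) := by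
  have h1 : (stalkToCone x).comp
      (MvPolynomial.aeval fun j => germHom S (chart i) x hx (ratio i j)) =
      MvPolynomial.aeval fun j => (coordIn ConeField i)⁻¹ * coordIn ConeField j := by
    refine MvPolynomial.algHom_ext fun j => ?_
    rw [AlgHom.comp_apply, MvPolynomial.aeval_X, MvPolynomial.aeval_X, stalkToCone_ratio]
  have h2 : MvPolynomial.aeval (coordIn ConeField) =
      (IsScalarTower.toAlgHom ℂ CoordRing ConeField).comp toCoordRing :=
    MvPolynomial.algHom_ext fun j => MvPolynomial.aeval_X _ j
  refine (DFunLike.congr_fun h1 p).trans ?_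
  rw [aeval_mul_of_isHomogeneous hp, h2]
  rfl

theorem stalkToCone_stalkIso_symm (x : S.left)
    (c : HomogeneousLocalization.NumDenSameDeg grading
      (show ProjectiveSpectrum grading from x).asHomogeneousIdeal.toIdeal.primeCompl) :
    stalkToCone x ((Proj.stalkIso' grading x).symm (HomogeneousLocalization.mk c)) =
      algebraMap CoordRing ConeField c.num / algebraMap CoordRing ConeField c.den := by
  have := (show ProjectiveSpectrum grading from x).isPrime
  have h := (Proj.stalkIso' grading x).apply_symm_apply (HomogeneousLocalization.mk c)
  refine (congrArg (fun z => localizationToConeField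
    (show ProjectiveSpectrum grading from x).asHomogeneousIdeal.toIdeal
    (HomogeneousLocalization.val z)) h).trans ?_
  dsimp only
  rw [HomogeneousLocalization.val_mk, Localization.mk_eq_mk']
  exact localizationToConeField_mk'
    (show ProjectiveSpectrum grading from x).asHomogeneousIdeal.toIdeal _ _

/-- The last clause records that q does not vanish at x: every numerator of the same degree is
allowed over q. It later supplies inverses. -/
theorem exists_stalkToCone_eq_div {x : S.left} (r : S.left.presheaf.stalk x) :
    ∃ (n : ℕ) (p q : MvPolynomial (Fin 4) ℂ), p.IsHomogeneous n ∧ q.IsHomogeneous n ∧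
      toCoordRing q ≠ 0 ∧ stalkToCone x r = algebraMap CoordRing ConeField (toCoordRing p) /
        algebraMap CoordRing ConeField (toCoordRing q) ∧
      ∀ p' : MvPolynomial (Fin 4) ℂ, p'.IsHomogeneous n → ∃ r' : S.left.presheaf.stalk x,
        stalkToCone x r' = algebraMap CoordRing ConeField (toCoordRing p') /
          algebraMap CoordRing ConeField (toCoordRing q) := by
  obtain ⟨⟨n, ⟨_, p, hp, rfl⟩, ⟨_, q, hq, rfl⟩, hqx⟩, hr⟩ :=
    HomogeneousLocalization.mk_surjective (Proj.stalkIso' grading x r)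
  refine ⟨n, p, q, hp, hq, fun h0 => hqx ?_, ?_, fun p' hp' =>
    ⟨_, stalkToCone_stalkIso_symm x
      ⟨n, ⟨toCoordRing p', toCoordRing_mem hp'⟩, ⟨toCoordRing q, toCoordRing_mem hq⟩, hqx⟩⟩⟩
  · change toCoordRing q ∈ _
    rw [h0]
    exact zero_mem _
  · have hr' := (Proj.stalkIso' grading x).symm_apply_apply r
    rw [← hr] at hr'
    exact (congrArg (stalkToCone x) hr').symm.trans (stalkToCone_stalkIso_symm x _)

theorem exists_fraction {x : S.left} {i : Fin 4} (hx : x ∈ chart i)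
    (r : S.left.presheaf.stalk x) : ∃ p q : MvPolynomial (Fin 4) ℂ,
      IsUnit (MvPolynomial.aeval (fun j => germHom S (chart i) x hx (ratio i j)) q) ∧
      r * MvPolynomial.aeval (fun j => germHom S (chart i) x hx (ratio i j)) q =
        MvPolynomial.aeval (fun j => germHom S (chart i) x hx (ratio i j)) p := by
  obtain ⟨n, p, q, hp, hq, hq0, hr, h⟩ := exists_stalkToCone_eq_div r
  have hq1 : algebraMap CoordRing ConeField (toCoordRing q) ≠ 0 := fun h0 =>
    hq0 (IsFractionRing.injective CoordRing ConeField (h0.trans (map_zero _).symm))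
  have hi := coordIn_ne_zero (L := ConeField) i
  refine ⟨p, q, ?_, ?_⟩
  -- In affine coordinates q becomes q / Xᵢⁿ, whose inverse Xᵢⁿ / q lies in the local ring.
  · obtain ⟨r', hr'⟩ := h _ (MvPolynomial.isHomogeneous_X_pow i n)
    refine IsUnit.of_mul_eq_one r' (stalkToCone_injective x ?_)
    rw [map_mul (stalkToCone x), hr', stalkToCone_aeval_ratio hx hq, map_one (stalkToCone x),
      map_pow, map_pow]
    change (coordIn ConeField i)⁻¹ ^ n * _ * (coordIn ConeField i ^ n / _) = 1
    rw [inv_pow]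
    field_simp
  · refine stalkToCone_injective x ?_
    rw [map_mul (stalkToCone x), stalkToCone_aeval_ratio hx hq, stalkToCone_aeval_ratio hx hp, hr]
    field_simp

theorem D_aeval_mem_span {R : Type} [CommRing R] [Algebra ℂ R] (t : Fin 4 → R)
    (p : MvPolynomial (Fin 4) ℂ) : KaehlerDifferential.D ℂ R (MvPolynomial.aeval t p) ∈
      Submodule.span R (Set.range fun j => KaehlerDifferential.D ℂ R (t j)) := by
  induction p using MvPolynomial.induction_on with
  | C a => simp
  | add p q hp hq => rw [map_add, map_add]; exact add_mem hp hq
  | mul_X p j hp =>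
    rw [map_mul, Derivation.leibniz, MvPolynomial.aeval_X]
    exact add_mem (Submodule.smul_mem _ _ (Submodule.subset_span ⟨j, rfl⟩))
      (Submodule.smul_mem _ _ hp)

/-- The quotient rule: r q = p gives q dr = dp - r dq with q a unit and p, q polynomials in the
affine coordinates. -/
theorem span_D_ratio {x : S.left} {i : Fin 4} (hx : x ∈ chart i) :
    Submodule.span (S.left.presheaf.stalk x) (Set.range fun j =>
      KaehlerDifferential.D ℂ (S.left.presheaf.stalk x)
        (germHom S (chart i) x hx (ratio i j))) = ⊤ := by
  rw [eq_top_iff, ← KaehlerDifferential.span_range_derivation, Submodule.span_le]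
  rintro _ ⟨r, rfl⟩
  obtain ⟨p, q, hq, h⟩ := exists_fraction hx r
  have h1 := congrArg (KaehlerDifferential.D ℂ (S.left.presheaf.stalk x)) h
  rw [Derivation.leibniz, ← eq_sub_iff_add_eq'] at h1
  refine (Submodule.smul_mem_iff_of_isUnit _ hq).1 ?_
  rw [h1]
  exact sub_mem (D_aeval_mem_span _ p) (Submodule.smul_mem _ _ (D_aeval_mem_span _ q))

end Charts

/-! ### Global 2-forms as constant multiples of the residue form. -/

section GlobalForms

theorem algebraMap_smul_form {R : Type} [CommRing R] [Algebra ℂ R] (c : ℂ)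
    (w : ⋀[R]^2 Ω[R⁄ℂ]) : algebraMap ℂ R c • w = c • w :=
  algebraMap_smul R c w

/-- The cospecialization map to the local ring at the generic point. -/
def toGenericStalk (x : S.left) :
    S.left.presheaf.stalk x →ₐ[ℂ] S.left.presheaf.stalk (genericPoint S.left) where
  toRingHom := (S.left.presheaf.stalkSpecializes
    ((genericPoint_spec S.left).specializes trivial)).hom
  commutes' c := by
    have h := congr($(S.left.presheaf.germ_stalkSpecializes (U := ⊤) (y := x) trivial
      ((genericPoint_spec S.left).specializes trivial)).hom (algebraMap ℂ Γ(S.left, ⊤) c))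
    exact h

theorem genericPoint_mem {U : S.left.Opens} {x : S.left} (hx : x ∈ U) :
    genericPoint S.left ∈ U :=
  ((genericPoint_spec S.left).mem_open_set_iff U.isOpen).2 ⟨x, trivial, hx⟩

theorem toGenericStalk_germHom {U : S.left.Opens} {x : S.left} (hx : x ∈ U) (s : Γ(S.left, U)) :
    toGenericStalk x (germHom S U x hx s) =
      germHom S U (genericPoint S.left) (genericPoint_mem hx) s :=
  congr($(S.left.presheaf.germ_stalkSpecializes (U := U) (y := x) hx
    ((genericPoint_spec S.left).specializes trivial)).hom s)

/-- Both maps agree on the affine coordinates, hence on fractions of polynomials in them.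
Consequently a section has the same image in the cone field at all points of its domain. -/
theorem stalkToCone_toGenericStalk (x : S.left) (r : S.left.presheaf.stalk x) :
    stalkToCone (genericPoint S.left) (toGenericStalk x r) = stalkToCone x r := by
  obtain ⟨i, hi⟩ := exists_mem_chart x
  obtain ⟨p, q, hq, h⟩ := exists_fraction hi r
  have key (p : MvPolynomial (Fin 4) ℂ) :
      stalkToCone (genericPoint S.left) (toGenericStalk x
        (MvPolynomial.aeval (fun j => germHom S (chart i) x hi (ratio i j)) p)) =
      stalkToCone x (MvPolynomial.aeval (fun j => germHom S (chart i) x hi (ratio i j)) p) := by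
    have h1 : ((stalkToCone (genericPoint S.left)).comp (toGenericStalk x)).comp
          (MvPolynomial.aeval (fun j => germHom S (chart i) x hi (ratio i j))) =
        (stalkToCone x).comp
          (MvPolynomial.aeval (fun j => germHom S (chart i) x hi (ratio i j))) := by
      refine MvPolynomial.algHom_ext fun j => ?_
      simp only [AlgHom.comp_apply, MvPolynomial.aeval_X]
      rw [toGenericStalk_germHom, stalkToCone_ratio, stalkToCone_ratio]
    exact DFunLike.congr_fun h1 p
  have h2 := congrArg (fun r => stalkToCone (genericPoint S.left) (toGenericStalk x r)) h
  have h3 := congrArg (stalkToCone x) h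
  simp only [map_mul, key] at h2
  rw [map_mul (stalkToCone x), ← h2] at h3
  exact (mul_right_cancel₀ (hq.map (stalkToCone x)).ne_zero h3).symm

theorem stalkToCone_comp_germHom {U : S.left.Opens} {x y : S.left} (hx : x ∈ U) (hy : y ∈ U) :
    (stalkToCone x).comp (germHom S U x hx) = (stalkToCone y).comp (germHom S U y hy) := by
  ext s
  rw [AlgHom.comp_apply, AlgHom.comp_apply, ← stalkToCone_toGenericStalk,
    ← stalkToCone_toGenericStalk y, toGenericStalk_germHom, toGenericStalk_germHom]

/-- The extension of a `2`-form near `x` to a rational form on the cone. -/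
abbrev coneForm (x : S.left) : (⋀[S.left.presheaf.stalk x]^2 Ω[S.left.presheaf.stalk x⁄ℂ]) →ₗ[ℂ]
    ⋀[ConeField]^2 Ω[ConeField⁄ℂ] :=
  formsMap 2 (stalkToCone x)

theorem coneForm_formsMap_germHom {U : S.left.Opens} {x y : S.left} (hx : x ∈ U) (hy : y ∈ U)
    (θ : ⋀[Γ(S.left, U)]^2 Ω[Γ(S.left, U)⁄ℂ]) :
    coneForm x (formsMap 2 (germHom S U x hx) θ) = coneForm y (formsMap 2 (germHom S U y hy) θ) := by
  rw [coneForm, coneForm, ← formsMap_comp, ← formsMap_comp, stalkToCone_comp_germHom hx hy]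

/-- The residue form on the cone. -/
def coneResidue : ⋀[ConeField]^2 Ω[ConeField⁄ℂ] := residueForm (coordIn ConeField) 1

theorem coneResidue_ne_zero : coneResidue ≠ 0 := residueForm_coordIn_ne_zero

theorem isUnit_partials_coordIn (c : Fin 4) : IsUnit (partials (coordIn ConeField) c) :=
  (partials_coordIn_ne_zero c).isUnit

theorem residueForm_inv_mul_coordIn (i : Fin 4) (σ : Equiv.Perm (Fin 4)) :
    residueForm (fun j => (coordIn ConeField i)⁻¹ * coordIn ConeField j) σ = coneResidue := by
  rw [residueForm_smul (inv_ne_zero (coordIn_ne_zero i)).isUnit,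
    residueForm_eq quarticValue_coordIn isUnit_partials_coordIn, coneResidue]

theorem germHom_ratio_self {x : S.left} {i : Fin 4} (hx : x ∈ chart i) :
    germHom S (chart i) x hx (ratio i i) = 1 := by
  refine stalkToCone_injective x ?_
  rw [stalkToCone_ratio, map_one (stalkToCone x), inv_mul_cancel₀ (coordIn_ne_zero i)]

theorem quarticValue_germHom_ratio {x : S.left} {i : Fin 4} (hx : x ∈ chart i) :
    quarticValue (fun j => germHom S (chart i) x hx (ratio i j)) = 0 := by
  refine stalkToCone_injective x ?_
  rw [map_quarticValue, map_zero (stalkToCone x)]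
  simp only [stalkToCone_ratio]
  rw [← aeval_quartic, aeval_mul_of_isHomogeneous quartic_isHomogeneous, aeval_quartic,
    quarticValue_coordIn, mul_zero]

theorem exists_perm (i c : Fin 4) (h : c ≠ i) : ∃ σ : Equiv.Perm (Fin 4), σ 0 = i ∧ σ 3 = c := by
  revert i c
  decide

theorem exists_chart_perm (x : S.left) : ∃ (i : Fin 4) (hx : x ∈ chart i)
    (σ : Equiv.Perm (Fin 4)), σ 0 = i ∧
      IsUnit (partials (fun j => germHom S (chart i) x hx (ratio i j)) (σ 3)) := by
  obtain ⟨i, hi⟩ := exists_mem_chart x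
  obtain ⟨c, hc, h⟩ := exists_isUnit_partials (quarticValue_germHom_ratio hi)
    (i := i) (by rw [germHom_ratio_self]; exact isUnit_one)
  obtain ⟨σ, h0, rfl⟩ := exists_perm i c hc
  exact ⟨i, hi, σ, h0, h⟩

theorem coneForm_residueForm {x : S.left} {i : Fin 4} (hx : x ∈ chart i)
    (σ : Equiv.Perm (Fin 4))
    (hσ : IsUnit (partials (fun j => germHom S (chart i) x hx (ratio i j)) (σ 3))) :
    coneForm x (residueForm (fun j => germHom S (chart i) x hx (ratio i j)) σ) = coneResidue := by
  rw [coneForm, formsMap_residueForm _ _ _ hσ]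
  simp only [stalkToCone_ratio]
  exact residueForm_inv_mul_coordIn i σ

/-- Near every point the stalk of the sheaf of `2`-forms is freely generated by the residue form. -/
theorem exists_stalk_generator (x : S.left) :
    ∃ w : ⋀[S.left.presheaf.stalk x]^2 Ω[S.left.presheaf.stalk x⁄ℂ],
      Submodule.span (S.left.presheaf.stalk x) {w} = ⊤ ∧ coneForm x w = coneResidue := by
  obtain ⟨i, hx, σ, h0, hσ⟩ := exists_chart_perm x
  refine ⟨_, span_residueForm (quarticValue_germHom_ratio hx) σ ?_ hσ (span_D_ratio hx),
    coneForm_residueForm hx σ hσ⟩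
  rw [h0]
  exact germHom_ratio_self hx

theorem exists_coneForm_eq_smul {x : S.left}
    (w : ⋀[S.left.presheaf.stalk x]^2 Ω[S.left.presheaf.stalk x⁄ℂ]) :
    ∃ r : S.left.presheaf.stalk x, coneForm x w = stalkToCone x r • coneResidue ∧
      (stalkToCone x r = 0 → w = 0) := by
  obtain ⟨v, hv, hv'⟩ := exists_stalk_generator x
  obtain ⟨r, rfl⟩ := Submodule.mem_span_singleton.1 (hv ▸ Submodule.mem_top (x := w))
  refine ⟨r, by rw [coneForm, formsMap_smul]; exact congrArg _ hv', fun h => ?_⟩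
  rw [(stalkToCone_injective x) (h.trans (map_zero (stalkToCone x)).symm), zero_smul]

/-- The 2-form germs are generated by one form whose image is nonzero, and the local ring embeds in
the cone field. -/
theorem coneForm_injective (x : S.left) : Function.Injective (coneForm x) := by
  rw [injective_iff_map_eq_zero]
  intro w hw
  obtain ⟨r, hr, hr'⟩ := exists_coneForm_eq_smul w
  rw [hw, eq_comm, smul_eq_zero, or_iff_left coneResidue_ne_zero] at hr
  exact hr' hr

/-- The rational form on the cone of a global form. -/
def globalConeForm : globalForms S 2 →ₗ[ℂ] ⋀[ConeField]^2 Ω[ConeField⁄ℂ] where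
  toFun s := coneForm (genericPoint S.left) (s.1 (genericPoint S.left))
  map_add' _ _ := (coneForm (genericPoint S.left)).map_add _ _
  map_smul' c _ := (coneForm (genericPoint S.left)).map_smul c _

theorem coneForm_globalForms (s : globalForms S 2) (x : S.left) :
    coneForm x (s.1 x) = globalConeForm s := by
  obtain ⟨U, hU, θ, hθ⟩ := s.2 x
  change _ = coneForm (genericPoint S.left) (s.1 (genericPoint S.left))
  rw [hθ x hU, hθ _ (genericPoint_mem hU)]
  exact coneForm_formsMap_germHom _ _ θ

theorem globalConeForm_injective : Function.Injective globalConeForm := by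
  intro s t h
  refine Subtype.ext (funext fun x => coneForm_injective x ?_)
  rw [coneForm_globalForms, coneForm_globalForms, h]

theorem isUnit_partials_resHom (i c : Fin 4) :
    IsUnit (partials (fun j => resHom S (S.left.basicOpen_le (partials (ratio i) c)) (ratio i j))
      c) := by
  rw [← map_partials]
  exact RingedSpace.isUnit_res_basicOpen _ _

/-- Generators chosen independently at each point are compatible because their common image
`coneResidue` determines them. Near x they are the germs of the residue form on the open set where a
suitable partial is invertible. -/
theorem exists_globalForm : ∃ s : globalForms S 2, globalConeForm s = coneResidue := by
  choose w hw hw' using exists_stalk_generator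
  refine ⟨⟨w, fun x => ?_⟩, hw' _⟩
  obtain ⟨i, hx, σ, h0, hσ⟩ := exists_chart_perm x
  have hxU : x ∈ S.left.basicOpen (partials (ratio i) (σ 3)) := by
    refine (S.left.mem_basicOpen _ x hx).2 ?_
    rw [← map_partials] at hσ
    exact hσ
  refine ⟨_, hxU, residueForm (fun j => resHom S (S.left.basicOpen_le _) (ratio i j)) σ,
    fun y hy => coneForm_injective y ?_⟩
  have hy' : y ∈ chart i := S.left.basicOpen_le _ hy
  have hg (j : Fin 4) : germHom S _ y hy (resHom S (S.left.basicOpen_le _) (ratio i j)) =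
      germHom S (chart i) y hy' (ratio i j) :=
    DFunLike.congr_fun (germHom_comp_resHom S (S.left.basicOpen_le _) y hy) _
  have hu := (isUnit_partials_resHom i (σ 3)).map (germHom S _ y hy)
  rw [map_partials] at hu
  rw [hw', formsMap_residueForm _ _ _ (isUnit_partials_resHom i (σ 3))]
  simp only [hg] at hu ⊢
  exact (coneForm_residueForm hy' σ hu).symm

/-- A rational function on the cone which is regular everywhere on `S` is constant. -/
theorem eq_algebraMap_of_forall_stalk {g : ConeField}
    (hg : ∀ x, ∃ r, stalkToCone x r = g) : ∃ c : ℂ, algebraMap ℂ ConeField c = g := by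
  have h (x : S.left) : ∃ (U : S.left.Opens) (_ : x ∈ U) (s : Γ(S.left, U)),
      ∀ (y : S.left) (hy : y ∈ U), stalkToCone y (germHom S U y hy s) = g := by
    obtain ⟨r, rfl⟩ := hg x
    obtain ⟨U, hx, s, rfl⟩ := S.left.presheaf.exists_germ_eq r
    exact ⟨U, hx, s, fun y hy => DFunLike.congr_fun (stalkToCone_comp_germHom hy hx) s⟩
  choose U hU s hs using h
  -- The local sections agree on overlaps because their germs all map to g and the local rings embed
  -- in the cone field.
  obtain ⟨t, ht, -⟩ := S.left.sheaf.existsUnique_gluing' U ⊤ (fun x => homOfLE le_top)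
    (fun x _ => Opens.mem_iSup.2 ⟨x, hU x⟩) s fun x y => by
      refine TopCat.Presheaf.section_ext S.left.sheaf _ _ _ fun z hz => stalkToCone_injective z ?_
      refine (congrArg (stalkToCone z) (DFunLike.congr_fun
        (germHom_comp_resHom S (inf_le_left (a := U x) (b := U y)) z hz) (s x))).trans ?_
      refine Eq.trans ?_ (congrArg (stalkToCone z) (DFunLike.congr_fun
        (germHom_comp_resHom S (inf_le_right (a := U x) (b := U y)) z hz) (s y))).symm
      rw [hs, hs]
  obtain ⟨c, rfl⟩ := algebraMap_sections_surjective t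
  refine ⟨c, ?_⟩
  let x := genericPoint S.left
  rw [← hs x x (hU x), ← ht x]
  refine Eq.trans ?_ (congrArg (stalkToCone x) (DFunLike.congr_fun
    (germHom_comp_resHom S (le_top (a := U x)) x (hU x)) (algebraMap ℂ Γ(S.left, ⊤) c))).symm
  rw [AlgHom.commutes, AlgHom.commutes]

/-- At every point the coefficient of `coneResidue` comes from the local ring; as `coneResidue` is
nonzero this coefficient is a single rational function, regular everywhere. -/
theorem exists_globalConeForm_eq_smul (s : globalForms S 2) :
    ∃ c : ℂ, globalConeForm s = algebraMap ℂ ConeField c • coneResidue := by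
  have h (x : S.left) : ∃ r, globalConeForm s = stalkToCone x r • coneResidue := by
    obtain ⟨r, hr, -⟩ := exists_coneForm_eq_smul (s.1 x)
    exact ⟨r, (coneForm_globalForms s x).symm.trans hr⟩
  obtain ⟨r₀, hr₀⟩ := h (genericPoint S.left)
  obtain ⟨c, hc⟩ := eq_algebraMap_of_forall_stalk (g := stalkToCone _ r₀) fun x => by
    obtain ⟨r, hr⟩ := h x
    exact ⟨r, smul_left_injective _ coneResidue_ne_zero (hr.symm.trans hr₀)⟩
  exact ⟨c, hr₀.trans (congrArg (· • coneResidue) hc.symm)⟩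

theorem globalConeForm_smul (c : ℂ) (s : globalForms S 2) :
    globalConeForm (c • s) = algebraMap ℂ ConeField c • globalConeForm s :=
  (globalConeForm.map_smul c s).trans (algebraMap_smul_form c _).symm

theorem finrank_globalForms : Module.finrank ℂ (globalForms S 2) = 1 := by
  obtain ⟨s, hs⟩ := exists_globalForm
  refine finrank_eq_one s (fun h => coneResidue_ne_zero ?_) fun t => ?_
  · rw [← hs, h, map_zero]
  · obtain ⟨c, hc⟩ := exists_globalConeForm_eq_smul t
    exact ⟨c, globalConeForm_injective ((globalConeForm_smul c s).trans (by rw [hs, hc]))⟩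

end GlobalForms

/-! ### The action of the automorphism and its order. -/

section Automorphism

/-- The weights with which `scaleMap ζ` scales the homogeneous coordinates. -/
def weights (ζ : ℂ) : Fin 4 → ℂ := ![ζ, 1, ζ, 1]

theorem scaleHom_coord (ζ : ℂ) (hζ : ζ ^ 3 = 1) (j : Fin 4) :
    scaleHom ζ hζ (coord j) = algebraMap ℂ CoordRing (weights ζ j) * coord j := by
  have h : scalePoly ζ (MvPolynomial.X j) = MvPolynomial.C (weights ζ j) * MvPolynomial.X j := by
    fin_cases j <;> simp [scalePoly, weights]
  rw [coord, scaleHom_toCoordRing, h, map_mul]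
  rfl

theorem stalkToCone_stalkHom_scaleMap (ζ : ℂ) (hζ : ζ ^ 3 = 1) (x : S.left) (i : Fin 4)
    (hx : (scaleMap ζ hζ).left x ∈ chart i) (j : Fin 4) :
    stalkToCone x (stalkHom (scaleMap ζ hζ) x (germHom S (chart i) _ hx (ratio i j))) =
      (algebraMap ℂ ConeField (weights ζ i) * coordIn ConeField i)⁻¹ *
        (algebraMap ℂ ConeField (weights ζ j) * coordIn ConeField j) := by
  have h1 : stalkHom (scaleMap ζ hζ) x (germHom S (chart i) _ hx (ratio i j)) =
      germHom S ((scaleMap ζ hζ).left ⁻¹ᵁ chart i) x hx (appHom (scaleMap ζ hζ) (chart i)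
        (ratio i j)) :=
    DFunLike.congr_fun (stalkHom_comp_germHom (scaleMap ζ hζ) (chart i) x hx) (ratio i j)
  have h2 : appHom (scaleMap ζ hζ) (chart i) (ratio i j) =
      (Proj.awayToSection grading (scaleHom ζ hζ (coord i))).hom
        (HomogeneousLocalization.Away.mk grading ((scaleHom ζ hζ).map_mem (coord_mem i)) 1
          (scaleHom ζ hζ (coord j)) ((scaleHom ζ hζ).map_mem (by
            rw [one_smul]; exact coord_mem j))) := by
    have h := congr($(Proj.awayToSection_comp_appLE (scaleHom ζ hζ) (scaleHom_irrelevant ζ hζ)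
      (coord_mem i)).hom (HomogeneousLocalization.Away.mk grading (coord_mem i) 1 (coord j)
      (by rw [one_smul]; exact coord_mem j)))
    rw [CommRingCat.hom_comp, CommRingCat.hom_comp, RingHom.comp_apply, RingHom.comp_apply,
      CommRingCat.hom_ofHom, HomogeneousLocalization.Away.map_mk] at h
    exact Eq.trans congr($((Scheme.Hom.appLE_eq_app
      (Proj.map (scaleHom ζ hζ) (scaleHom_irrelevant ζ hζ)) (U := chart i)).symm).hom _) h
  rw [h1, h2]
  refine (stalkToConeField_germ x ((scaleHom ζ hζ).map_mem (coord_mem i)) hx 1 _ _).trans ?_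
  change algebraMap CoordRing ConeField (scaleHom ζ hζ (coord j)) /
    algebraMap CoordRing ConeField (scaleHom ζ hζ (coord i)) ^ 1 = _
  rw [pow_one, scaleHom_coord, scaleHom_coord, map_mul, map_mul, div_eq_inv_mul,
    ← IsScalarTower.algebraMap_apply, ← IsScalarTower.algebraMap_apply]
  rfl

theorem quarticValue_weights {R : Type} [CommRing R] [Algebra ℂ R] {ζ : ℂ} (hζ : ζ ^ 3 = 1)
    (t : Fin 4 → R) :
    quarticValue (fun j => algebraMap ℂ R (weights ζ j) * t j) = quarticValue t := by
  have h : algebraMap ℂ R ζ ^ 3 = 1 := by rw [← map_pow, hζ, map_one]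
  simp [quarticValue, weights, mul_pow, h]

/-- The quartic is invariant, so each partial scales by the inverse weight of its variable, which is
the square because weights are cube roots of unity. -/
theorem partials_weights {R : Type} [CommRing R] [Algebra ℂ R] {ζ : ℂ} (hζ : ζ ^ 3 = 1)
    (t : Fin 4 → R) (c : Fin 4) :
    partials (fun j => algebraMap ℂ R (weights ζ j) * t j) c =
      algebraMap ℂ R (weights ζ c) ^ 2 * partials t c := by
  have h : algebraMap ℂ R ζ ^ 3 = 1 := by rw [← map_pow, hζ, map_one]
  fin_cases c
  · simp [partials, weights, mul_pow]
    ring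
  · simp [partials, weights, mul_pow, h]
  · simp [partials, weights, mul_pow]
    ring
  · simp [partials, weights, mul_pow, h]

theorem weights_ne_zero {ζ : ℂ} (hζ : ζ ^ 3 = 1) (i : Fin 4) : weights ζ i ≠ 0 := by
  have : ζ ≠ 0 := by rintro rfl; norm_num at hζ
  fin_cases i <;> simp [weights, this]

/-- Independence of σ reduces to the identity permutation: the Euler form has weight ζ · 1 · ζ and
the partial in the last variable has weight 1. -/
theorem residueForm_weights {R : Type} [CommRing R] [Algebra ℂ R] {ζ : ℂ} (hζ : ζ ^ 3 = 1)
    {t : Fin 4 → R} (h0 : quarticValue t = 0) (ht : ∀ c, IsUnit (partials t c))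
    (σ : Equiv.Perm (Fin 4)) :
    residueForm (fun j => algebraMap ℂ R (weights ζ j) * t j) σ =
      algebraMap ℂ R (ζ ^ 2) • residueForm t 1 := by
  rw [residueForm_eq ((quarticValue_weights hζ t).trans h0) fun c => by
      rw [partials_weights hζ]
      exact (((weights_ne_zero hζ c).isUnit.map (algebraMap ℂ R)).pow 2).mul (ht c),
    residueForm, residueForm, eulerForm_diag, Equiv.Perm.one_apply, Equiv.Perm.one_apply,
    Equiv.Perm.one_apply, Equiv.Perm.one_apply, partials_weights hζ]
  simp [weights, sq]
  exact smul_comm _ _ _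

theorem residueForm_inv_mul_weights {F : Type} [Field F] [Algebra ℂ F] {ζ : ℂ} (hζ : ζ ^ 3 = 1)
    {t : Fin 4 → F} (h0 : quarticValue t = 0) (ht : ∀ c, IsUnit (partials t c)) (i : Fin 4)
    (hi : t i ≠ 0) (σ : Equiv.Perm (Fin 4)) :
    residueForm (fun j => (algebraMap ℂ F (weights ζ i) * t i)⁻¹ *
      (algebraMap ℂ F (weights ζ j) * t j)) σ = algebraMap ℂ F (ζ ^ 2) • residueForm t 1 := by
  have hw : algebraMap ℂ F (weights ζ i) ≠ 0 := (map_ne_zero _).2 (weights_ne_zero hζ i)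
  rw [residueForm_smul (inv_ne_zero (mul_ne_zero hw hi)).isUnit, residueForm_weights hζ h0 ht]

/-- At the image of the generic point s is the residue form in affine coordinates, by injectivity of
`coneForm`. Pulling back replaces the homogeneous coordinates by their weighted versions. -/
theorem globalConeForm_pullbackForms (ζ : ℂ) (hζ : ζ ^ 3 = 1) {s : globalForms S 2}
    (hs : globalConeForm s = coneResidue) :
    globalConeForm (pullbackForms (scaleMap ζ hζ) 2 s) =
      algebraMap ℂ ConeField (ζ ^ 2) • coneResidue := by
  let x := genericPoint S.left
  obtain ⟨i, hi, σ, h0, hσ⟩ := exists_chart_perm ((scaleMap ζ hζ).left x)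
  have hs' : s.1 ((scaleMap ζ hζ).left x) = residueForm _ σ :=
    coneForm_injective _ (((coneForm_globalForms s _).trans hs).trans
      (coneForm_residueForm hi σ hσ).symm)
  change coneForm x (formsMap 2 (stalkHom (scaleMap ζ hζ) x) (s.1 ((scaleMap ζ hζ).left x))) = _
  rw [hs', coneForm, ← formsMap_comp, formsMap_residueForm _ _ _ hσ]
  refine Eq.trans (congrArg (fun t => residueForm t σ) (funext fun j =>
    stalkToCone_stalkHom_scaleMap ζ hζ x i hi j)) ?_
  exact residueForm_inv_mul_weights hζ quarticValue_coordIn isUnit_partials_coordIn i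
    (coordIn_ne_zero i) σ

theorem pullbackForms_scaleMap_of_eq_coneResidue (ζ : ℂ) (hζ : ζ ^ 3 = 1) {s : globalForms S 2}
    (hs : globalConeForm s = coneResidue) :
    pullbackForms (scaleMap ζ hζ) 2 s = ζ ^ 2 • s :=
  globalConeForm_injective ((globalConeForm_pullbackForms ζ hζ hs).trans
    ((globalConeForm_smul (ζ ^ 2) s).trans
      (congrArg (fun w => algebraMap ℂ ConeField (ζ ^ 2) • w) hs)).symm)

theorem pullbackForms_scaleMap (ζ : ℂ) (hζ : ζ ^ 3 = 1) (ω : globalForms S 2) :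
    pullbackForms (scaleMap ζ hζ) 2 ω = ζ ^ 2 • ω := by
  obtain ⟨s, hs⟩ := exists_globalForm
  obtain ⟨c, hc⟩ := exists_globalConeForm_eq_smul ω
  have hω : c • s = ω :=
    globalConeForm_injective ((globalConeForm_smul c s).trans
      ((congrArg (fun w => algebraMap ℂ ConeField c • w) hs).trans hc.symm))
  subst hω
  exact ((pullbackForms (scaleMap ζ hζ) 2).map_smul c s).trans
    ((congrArg (fun w => c • w) (pullbackForms_scaleMap_of_eq_coneResidue ζ hζ hs)).trans
      (smul_comm c (ζ ^ 2) s))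

theorem scaleHom_comp_self (ζ η : ℂ) (hζ : ζ ^ 3 = 1) (hη : η ^ 3 = 1) (h : ζ ^ 2 = η) :
    (scaleHom ζ hζ).comp (scaleHom ζ hζ) = scaleHom η hη := by
  have h1 : (scalePoly ζ).comp (scalePoly ζ) = scalePoly η := by
    refine MvPolynomial.algHom_ext fun i => ?_
    fin_cases i <;> simp [scalePoly, ← mul_assoc, ← sq, ← h]
  ext x
  obtain ⟨p, rfl⟩ := Ideal.Quotient.mk_surjective x
  exact congrArg toCoordRing (DFunLike.congr_fun h1 p)

theorem scaleMap_comp_self (ζ η : ℂ) (hζ : ζ ^ 3 = 1) (hη : η ^ 3 = 1) (h : ζ ^ 2 = η) :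
    scaleMap ζ hζ ≫ scaleMap ζ hζ = scaleMap η hη := by
  have h1 := scaleHom_comp_self ζ η hζ hη h
  refine Over.OverMorphism.ext ((Proj.map_comp (scaleHom ζ hζ) (scaleHom ζ hζ)
    (scaleHom_irrelevant ζ hζ) (scaleHom_irrelevant ζ hζ)).symm.trans ?_)
  change Proj.map _ _ = Proj.map (scaleHom η hη) (scaleHom_irrelevant η hη)
  simp only [h1]

theorem γ_pow_three : γ ^ 3 = 1 := by
  have h : γ * γ = γ⁻¹ := by
    ext1
    exact scaleMap_comp_self ξ (ξ ^ 2) _ _ rfl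
  rw [pow_succ, sq, h, inv_mul_cancel]

theorem ξ_sq_ne_one : ξ ^ 2 ≠ 1 := by
  intro h
  have h1 : ξ = 1 := by
    have := ξ_pow_three
    rw [pow_succ, h, one_mul] at this
    exact this
  rw [ξ, Complex.exp_eq_one_iff] at h1
  obtain ⟨n, hn⟩ := h1
  have hpi : (2 * Real.pi * Complex.I : ℂ) ≠ 0 := Complex.two_pi_I_ne_zero
  have h2 : (1 : ℂ) / 3 = n := mul_left_cancel₀ hpi (by rw [mul_one_div, hn, mul_comm])
  have h3 : (3 * n : ℂ) = 1 := by rw [← h2]; norm_num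
  have h4 : 3 * n = 1 := by exact_mod_cast h3
  omega

theorem formsMap_id {k A : Type} [CommRing k] [CommRing A] [Algebra k A] (n : ℕ)
    (w : ⋀[A]^n Ω[A⁄k]) : formsMap n (AlgHom.id k A) w = w := by
  have hw : w ∈ Submodule.span A (Set.range fun v : Fin n → A =>
    exteriorPower.ιMulti A n fun i => KaehlerDifferential.D k A (v i)) := by
    rw [span_ιMulti_D]; trivial
  induction hw using Submodule.span_induction with
  | mem x h => obtain ⟨v, rfl⟩ := h; simp [formsMap_ιMulti_D]
  | zero => simp
  | add x y _ _ hx hy => simp [hx, hy]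
  | smul a x _ hx => simp [formsMap_smul, hx]

theorem pullbackForms_id (ω : globalForms S 2) : pullbackForms (𝟙 S) 2 ω = ω := by
  refine Subtype.ext (funext fun x => ?_)
  have h : stalkHom (𝟙 S) x = AlgHom.id ℂ _ := by
    ext r
    exact congr($(Scheme.Hom.stalkMap_id S.left x).hom r)
  change formsMap 2 (stalkHom (𝟙 S) x) (ω.1 x) = ω.1 x
  exact (congrArg (fun φ => formsMap 2 φ (ω.1 x)) h).trans (formsMap_id 2 (ω.1 x))

/-- The identity would act trivially on the nonzero global form, which γ multiplies by ξ² ≠ 1. -/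
theorem γ_ne_one : γ ≠ 1 := by
  intro h
  obtain ⟨s, hs⟩ := exists_globalForm
  have h1 : pullbackForms γ.hom 2 s = ξ ^ 2 • s := pullbackForms_scaleMap ξ ξ_pow_three s
  have h2 : pullbackForms γ.hom 2 s = s := by
    rw [h]
    exact pullbackForms_id s
  have hs0 : s ≠ 0 := fun h => coneResidue_ne_zero (by rw [← hs, h, map_zero])
  have h3 : ξ ^ 2 • s = (1 : ℂ) • s := (h1.symm.trans h2).trans (one_smul ℂ s).symm
  have hinj := smul_left_injective (M := globalForms S 2) ℂ hs0
  exact ξ_sq_ne_one (hinj h3)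

theorem orderOf_γ : orderOf γ = 3 :=
  orderOf_eq_prime γ_pow_three γ_ne_one

end Automorphism

end QuarticK3
end

/-- The automorphism `γ` of the quartic surface `S` has order `3`, the space `Γ(S, ω_S)` of global
`2`-forms is one-dimensional over `ℂ`, and `γ` acts on it via pullback by multiplication
by `ξ ^ 2`. -/
theorem mainTheorem7 :
    orderOf QuarticK3.γ = 3 ∧
      Module.finrank ℂ (QuarticK3.globalForms QuarticK3.S 2) = 1 ∧
        ∀ ω : QuarticK3.globalForms QuarticK3.S 2,
          QuarticK3.pullbackForms QuarticK3.γ.hom 2 ω = QuarticK3.ξ ^ 2 • ω :=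
  ⟨QuarticK3.orderOf_γ, QuarticK3.finrank_globalForms,
    QuarticK3.pullbackForms_scaleMap _ QuarticK3.ξ_pow_three⟩
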